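/- Let $n$ be a positive integer. For a finite set $A\subseteq\mathbb{Z}/n\mathbb{Z}$ let $\Delta(A)$ denote the multiset of the $|A|^2$ differences $a-a'$ with $a,a'\in A$. Two sets $A,B\subseteq\mathbb{Z}/n\mathbb{Z}$ are called affinely equivalent if $B=uA+v$ for some unit $u$ of $\mathbb{Z}/n\mathbb{Z}$ and some $v\in\mathbb{Z}/n\mathbb{Z}$; two multisets $S,T$ of residues mod $n$ are called linearly equivalent if $T=uS$ for some unit $u$ of $\mathbb{Z}/n\mathbb{Z}$. For $k\ge 1$, let $\mathrm{SDA}(n,k)$ (the Same Difference Assertion) be the assertion that for all sets $A,B$ of $k$ residues mod $n$, the multisets $\Delta(A)$ and $\Delta(B)$ are linearly equivalent if and only if $A$ and $B$ are affinely equivalent. (In particular, $\Delta(A)=\Delta(B)$ implies that $A$ and $B$ are affinely equivalent.) Lemma. $\mathrm{SDA}(n,4)$ is true if $n$ is odd. $\mathrm{SDA}(n,5)$ is true if $n$ is coprime to $10$. -/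

import Mathlib

namespace Circulant

/-- The multiset `Δ(A)` of all `k ^ 2` differences `a - a'` with `a, a' ∈ A`
(in particular `0` occurs once for every element of `A`). -/
def diffMultiset {n : ℕ} (A : Finset (ZMod n)) : Multiset (ZMod n) :=
  (A ×ˢ A).val.map (fun p => p.1 - p.2)

/-- Two multisets `S, T` of residues are linearly equivalent if `T = u S` for a unit `u`. -/
def LinearlyEquivalent {n : ℕ} (S T : Multiset (ZMod n)) : Prop :=
  ∃ u : (ZMod n)ˣ, T = S.map (fun s => (u : ZMod n) * s)

/-- Two sets `A, B` of residues are affinely equivalent if `B = u A + v` for a unit `u` and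
some residue `v`. -/
def AffinelyEquivalent {n : ℕ} (A B : Finset (ZMod n)) : Prop :=
  ∃ (u : (ZMod n)ˣ) (v : ZMod n), B = A.image (fun a => (u : ZMod n) * a + v)

/-- The Same Difference Assertion: for all sets `A, B` of `k` residues mod `n`, the multisets of
differences `Δ(A)` and `Δ(B)` agree up to multiplication by a unit if and only if `A` and `B` are
affinely equivalent. -/
def SDA (n k : ℕ) : Prop :=
  ∀ A B : Finset (ZMod n), A.card = k → B.card = k →
    (LinearlyEquivalent (diffMultiset A) (diffMultiset B) ↔ AffinelyEquivalent A B)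

end Circulant

/-! ### A search procedure

The functions of this section are evaluated by the kernel, and are written with recursors because
the kernel reduces these fastest. -/

namespace Circulant
namespace Search

/-! Scaling A by the given unit reduces linear to exact equality of the difference multisets. Label
the K points of A and B as `a` and `b`. Up to sign, the K(K-1)/2 differences of pairs in A then
agree with those of B as multisets. A choice of matching and of signs is a system of linear
equations with integer coefficients in the 2K points, and there are finitely many choices.

The equations are solved for all admissible n at once. A state is a list of integer vectors v with
moduli m; the multiples t v with m t = 0 in ℤ/n span a submodule that contains the vector of points.
Each equation replaces this submodule by another that still contains the solutions
(`mem_span_impose`); it may be too large, and only the listed primes are treated as invertible. A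
branch closes when two points of one set coincide, or when some u a - b takes one value often
enough. By `search_spec` a successful search therefore forces an overlap, whatever the quality of
the auxiliary gcds and hashes.

Two reductions keep the search small. Say that there is a c-fold overlap if a translate of A or -A
shares c points with B. Without a threefold overlap, the differences b j - b 0 are differences of A
with distinct first points and distinct second points (`Homometric.exists_star`). Normalised, b j =
a (ρ j) - a j for a permutation ρ that matters only up to conjugation fixing 0; this leaves three
cases for K = 4 and five for K = 5. In each the search finds a threefold overlap or, for K = 4,
possibly a translate of 2A or -2A equal to B.

With a threefold overlap, three points may be taken to be common. For K = 4 a search finishes. For K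
= 5 the three common differences cancel, b 3 - b 4 is matched by hand with one of the seven others,
and searches raise the overlap to four and then to five (`Homometric.isAffine_of_first_three`). -/

/-- A column `(m, v)` stands for the multiples `t • v` of an integer vector with `m t = 0`. -/
abbrev Column := ℕ × List ℤ

/-- In a joint vector the indices below K are the points of A, and K, ..., 2K - 1 those of B. The
same type also holds pairs of one index from each set. -/
abbrev Edge := ℕ × ℕ

noncomputable section

variable {α β : Type}

/-! ### List operations and forced evaluation -/

def anyOf (p : α → Bool) (l : List α) : Bool :=
  List.rec false (fun x _ ih => Bool.rec ih true (p x)) l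

def allOf (p : α → Bool) (l : List α) : Bool :=
  List.rec true (fun x _ ih => Bool.rec false ih (p x)) l

def mapOf (f : α → β) (l : List α) : List β :=
  List.rec [] (fun x _ ih => f x :: ih) l

def filterOf (p : α → Bool) (l : List α) : List α :=
  List.rec [] (fun x _ ih => Bool.rec ih (x :: ih) (p x)) l

/-- `withNat x k` is `k x`, computed after reducing `x` to a literal; similarly for the next
ones. -/
def withNat (x : ℕ) (k : ℕ → α) : α :=
  Nat.rec (k 0) (fun m _ => k (Nat.succ m)) x

def withInt (x : ℤ) (k : ℤ → α) : α :=
  Int.rec (fun x => withNat x fun n => k (Int.ofNat n))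
    (fun x => withNat x fun n => k (Int.negSucc n)) x

def withInts (l : List ℤ) : (List ℤ → α) → α :=
  List.rec (fun k => k []) (fun x _ ih k => withInt x fun x => ih fun l => k (x :: l)) l

def withNats (l : List ℕ) : (List ℕ → α) → α :=
  List.rec (fun k => k []) (fun x _ ih k => withNat x fun x => ih fun l => k (x :: l)) l

def withColumns (l : List Column) : (List Column → α) → α :=
  List.rec (fun k => k []) (fun c _ ih k => withNat c.1 fun m => withInts c.2 fun v =>
    ih fun l => k ((m, v) :: l)) l

def withVectors (l : List (List ℤ)) : (List (List ℤ) → α) → α :=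
  List.rec (fun k => k []) (fun c _ ih k => withInts c fun v => ih fun l => k (v :: l)) l

def withCodes (l : List (Edge × ℕ)) : (List (Edge × ℕ) → α) → α :=
  List.rec (fun k => k []) (fun c _ ih k => withNat c.2 fun v => withNat c.1.1 fun i =>
    withNat c.1.2 fun j => ih fun l => k (((i, j), v) :: l)) l

/-! ### Integer vectors and unimodular reduction -/

def isZero (x : ℤ) : Bool := Int.rec (fun n => Nat.beq n 0) (fun _ => false) x

def nth (l : List ℤ) : ℕ → ℤ :=
  List.rec (fun _ => Int.ofNat 0) (fun x _ ih n => Nat.rec x (fun m _ => ih m) n) l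

/-- The linear combination `x v + y w`. -/
def lin (x y : ℤ) (v : List ℤ) : List ℤ → List ℤ :=
  List.rec (fun w => mapOf (fun b => Int.mul y b) w)
    (fun a v ih w => List.rec (mapOf (fun a => Int.mul x a) (a :: v))
      (fun b w _ => Int.add (Int.mul x a) (Int.mul y b) :: ih w) w) v

def diff (v : List ℤ) (e : Edge) : ℤ := Int.sub (nth v e.1) (nth v e.2)

/-- Coefficients `x, y` for which `x c + y d` is a greatest common divisor of `c` and `d`. -/
def bezout (k : ℕ) : ℤ → ℤ → ℤ × ℤ :=
  Nat.rec (fun _ _ => (1, 0)) (fun _ ih c d =>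
    Bool.rec (withInt (Int.ediv c d) fun q => withInt (Int.sub c (Int.mul q d)) fun r =>
        Prod.rec (fun x y => (y, Int.sub x (Int.mul q y))) (ih d r)) (1, 0) (isZero d)) k

/-- A unimodular change of two vectors, given the values `a`, `b` of a functional at them, after
which the functional vanishes at the second vector. -/
def merge (a b : ℤ) (v w : List ℤ) : List ℤ × List ℤ :=
  Bool.rec (Prod.rec (fun x y => withInt x fun x => withInt y fun y =>
    withInt (Int.add (Int.mul x a) (Int.mul y b)) fun g =>
    withInt (Int.ediv a g) fun s => withInt (Int.ediv b g) fun t =>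
    Bool.rec (v, w) (lin x y v w, lin (Int.neg t) s v w)
      (isZero (Int.sub (Int.add (Int.mul x s) (Int.mul y t)) 1))) (bezout 20 a b))
    (v, w) (isZero b)

/-- Gather the values of a functional at the free columns in one vector. -/
def split (L : List ℤ → ℤ) (l : List Column) : List ℤ × List Column :=
  List.rec ([], []) (fun c _ ih =>
    Prod.rec (fun w out =>
      Bool.rec (w, c :: out)
        (withInt (L c.2) fun a => withInt (L w) fun b =>
          Prod.rec (fun v w => (v, (0, w) :: out)) (merge a b c.2 w))
        (Nat.beq c.1 0)) ih) l

/-! ### Imposing one linear relation -/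

def stripPrime (p : ℕ) (k : ℕ) : ℕ → ℕ :=
  Nat.rec (fun g => g) (fun _ ih g => Bool.rec g (ih (Nat.div g p)) (Nat.beq (Nat.mod g p) 0)) k

/-- Divide out the primes `ps`. -/
def strip (ps : List ℕ) (g : ℕ) : ℕ := List.rec g (fun p _ ih => stripPrime p 8 ih) ps

def modulo (x : ℤ) (m : ℕ) : ℤ := Bool.rec (Int.emod x (Int.ofNat m)) x (Nat.beq m 0)

def reduceBy (L : List ℤ → ℤ) (g : ℤ) (w : List ℤ) (c : Column) : Column :=
  Bool.rec (withInt (Int.ediv (L c.2) g) fun q => (c.1, lin 1 (Int.neg q) c.2 w)) c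
    (Nat.beq c.1 0)

def involved (L : List ℤ → ℤ) (c : Column) : Bool := Bool.not (isZero (modulo (L c.2) c.1))

def inverseMod (c : ℤ) (m : ℕ) : Option ℕ :=
  (List.range m).find? fun k => isZero (Int.emod (Int.sub (Int.mul c k) 1) m)

/-- The vanishing of a functional with value `g` at the vector `w` of infinite order; `h` is the
essential part of `g`. -/
def impose₀ (ps : List ℕ) (L : List ℤ → ℤ) (w : List ℤ) (out : List Column) (g : ℤ) (h : ℕ) :
    List Column :=
  match filterOf (involved L) out with
  | [] => Bool.rec ((h, w) :: out) out (Nat.beq h 1)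
  | [(m, v)] =>
    Bool.rec (Bool.rec
      -- If k inverts L v modulo m, then s g + t L v = 0 and m t = 0 give t = -k g s, so w and v
      -- merge into one column. Otherwise only m h s = 0 is retained.
      (match inverseMod (L v) m with
        | some k => (h * m, lin 1 (-(k * g)) w v) :: filterOf (fun c => Bool.not (involved L c)) out
        | none => (m * h, w) :: out)
      ((0, w) :: (Nat.gcd m (strip ps (L v).natAbs), v) ::
        filterOf (fun c => Bool.not (involved L c)) out) (isZero g))
      (mapOf (fun c => (c.1, lin g (Int.neg (L c.2)) c.2 w)) out) (Nat.beq h 1)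
  | nz =>
    -- The product of the moduli annihilates the torsion part, so multiplying the relation by it
    -- bounds the order of the coefficient of w.
    Bool.rec ((nz.foldr (fun c a => c.1 * a) h, w) :: out)
      (mapOf (fun c => (c.1, lin g (Int.neg (L c.2)) c.2 w)) out) (Nat.beq h 1)

/-- Impose the vanishing of a functional. -/
def impose (ps : List ℕ) (L : List ℤ → ℤ) (cs : List Column) : List Column :=
  Prod.rec (fun w out => withInt (L w) fun g => withNat (strip ps g.natAbs) fun h =>
    impose₀ ps L w (mapOf (reduceBy L g w) out) g h) (split L cs)

/-- Coordinates matter only modulo m, because m annihilates the coefficient. -/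
def tidy (c : Column) : Column :=
  Bool.rec (c.1, mapOf (fun x => modulo x c.1) c.2) c (Nat.beq c.1 0)

def relevant (c : Column) : Bool :=
  Bool.rec (Bool.not (allOf isZero c.2)) false (Nat.beq c.1 1)

def clean (cs : List Column) : List Column := filterOf relevant (mapOf tidy cs)

/-! ### Tests for agreement, coincidence and overlap -/

def vanishes (cs : List Column) (L : List ℤ → ℤ) : Bool :=
  allOf (fun c => isZero (modulo (L c.2) c.1)) cs

def sameInt (x y : ℤ) : Bool :=
  Int.rec (fun m => Int.rec (fun n => Nat.beq m n) (fun _ => false) y)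
    (fun m => Int.rec (fun _ => false) (fun n => Nat.beq m n) y) x

def sameVector (v : List ℤ) : List ℤ → Bool :=
  List.rec (fun w => List.rec true (fun _ _ _ => false) w)
    (fun a _ ih w => List.rec false (fun b w _ => Bool.rec false (ih w) (sameInt a b)) w) v

def countVector (x : List ℤ) (l : List (List ℤ)) : ℕ :=
  List.rec 0 (fun y _ ih => Bool.rec ih (Nat.succ ih) (sameVector x y)) l

/-- The coordinates of `u a - b` for the points `a`, `b` with the indices `ij`. -/
def shift (cs : List Column) (u : ℤ) (ij : Edge) : List ℤ :=
  mapOf (fun c => modulo (Int.sub (Int.mul u (nth c.2 ij.1)) (nth c.2 ij.2)) c.1) cs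

/-- Some value is taken by `u a - b` at least `c` times. -/
def overlaps (idx : List Edge) (cs : List Column) (u : ℤ) (c : ℕ) : Bool :=
  withVectors (mapOf (shift cs u) idx) fun l => anyOf (fun x => Nat.ble c (countVector x l)) l

/-- The differences along two edges agree up to sign. -/
def agree (cs : List Column) (e f : Edge) : Bool :=
  Bool.rec (vanishes cs fun v => Int.add (diff v e) (diff v f)) true
    (vanishes cs fun v => Int.sub (diff v e) (diff v f))

/-- A number that depends only on the difference along `e` up to sign. -/
def code (cs : List Column) (e : Edge) : ℕ :=
  Nat.add (Nat.mul 1048576 (Int.natAbs (List.rec 0 (fun c _ ih =>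
      Bool.rec ih (Int.add (diff c.2 e) (Int.mul 1009 ih)) (Nat.beq c.1 0)) cs)))
    (List.rec 0 (fun c _ ih => Bool.rec ((fun x => Nat.add (Nat.mul 1009 ih)
      (Nat.mul x (Nat.sub c.1 x))) (Int.toNat (modulo (diff c.2 e) c.1))) ih (Nat.beq c.1 0)) cs)

/-- Remove an edge that agrees with `e`. -/
def take? (cs : List Column) (e : Edge) (n : ℕ) (l : List (Edge × ℕ)) :
    Option (List (Edge × ℕ)) :=
  List.rec none (fun f l ih => Bool.rec (Option.rec none (fun r => some (f :: r)) ih)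
    (some l) (Bool.rec false (agree cs e f.1) (Nat.beq n f.2))) l

/-- Remove agreeing edges from two lists. -/
def cancel (cs : List Column) (k : List Edge → List Edge → α) (EA : List (Edge × ℕ))
    (EB : List Edge) : List Edge → α :=
  List.rec (fun EA s => k (mapOf Prod.fst EA) s)
   (fun e _ ih EA s => withNat (code cs e) fun n =>
     Option.rec (ih EA (e :: s)) (fun r => ih r s) (take? cs e n EA)) EB EA

/-- The coordinates of the points. -/
def rows (K : ℕ) (cs : List Column) : List (List ℤ) :=
  List.rec (List.replicate (Nat.add K K) []) (fun c _ ih =>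
    List.rec (fun _ => []) (fun x _ ih' r => List.rec [] (fun y r _ => (x :: y) :: ih' r) r)
      c.2 ih) cs

def repeats (l : List (List ℤ)) : Bool :=
  List.rec false (fun x l ih => Bool.rec ih true (anyOf (sameVector x) l)) l

/-- Hashes modulo `M` of the points. -/
def hashes (M : ℕ) (cs : List Column) : List ℕ :=
  List.rec [] (fun c _ ih => Bool.rec ih (List.rec (fun _ => []) (fun x _ ih' r =>
     (Int.toNat (Int.emod (Int.add x (Int.ofNat (Nat.mul 100 (List.rec 0 (fun y _ _ => y) r))))
       (Int.ofNat M))) :: ih' (List.rec [] (fun _ r _ => r) r)) c.2 ih)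
       (Bool.rec (Nat.beq c.1 M) true (Nat.beq c.1 0))) cs

/-- The number whose digits to the base `256` count the values of `u x - y` modulo `M`. -/
def histogram (M u : ℕ) (l r : List ℕ) : ℕ :=
  List.rec 0 (fun x _ ih => withNat (Nat.mul u x) fun x => List.rec ih (fun y _ ih' =>
    Nat.add (Nat.pow 256 (Nat.mod (Nat.sub (Nat.add x M) y) M)) ih') r) l

/-- The prime 509 serves when a free column occurs; otherwise the modulus of the first column is
used. -/
def hashModulus (cs : List Column) : ℕ :=
  Bool.rec (List.rec 509 (fun c _ _ => c.1) cs) 509 (anyOf (fun c => Nat.beq c.1 0) cs)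

/-- Some digit to the base `256` is at least `c`. -/
def hasPeak (c N : ℕ) : Bool :=
  -- The quotient is the number with 509 digits 1 to the base 256. Adding 128 - c to a digit sets
  -- its top bit exactly when the digit is at least c. Counts of at most 25 pairs cause no carry.
  Bool.not (Nat.beq (Nat.land
    (Nat.add N (Nat.mul (Nat.sub 128 c) (Nat.div (Nat.pow 256 509) 255)))
    (Nat.mul 128 (Nat.div (Nat.pow 256 509) 255))) 0)

/-- A fast necessary condition for `overlaps`. -/
def mayOverlap (K : ℕ) (cs : List Column) (u : ℤ) (c : ℕ) : Bool :=
  withNat (hashModulus cs) fun M => withNats (hashes M cs) fun l =>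
    hasPeak c (histogram M (Int.toNat (Int.emod u (Int.ofNat M))) (l.take K) (l.drop K))

/-- The number of points in each of the two sets, the pairs of indices of a point of each set, the
primes that are invertible, and the pairs `(u, c)` such that the search may stop when some value is
taken by `u a - b` at least `c` times. -/
structure Params where
  size : ℕ
  idx : List Edge
  primes : List ℕ
  shared : List (ℤ × ℕ)

def branch (f : Edge → List Edge → Bool) (l : List Edge) : List Edge → Bool :=
  List.rec (fun _ => true) (fun e l ih s => Bool.rec false (ih (e :: s)) (f e (s ++ l))) l

def degenerate (K : ℕ) (cs : List Column) : Bool :=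
  withVectors (rows K cs) fun l => Bool.rec (repeats (l.drop K)) true (repeats (l.take K))

def finished (P : Params) (cs : List Column) : Bool :=
  anyOf (fun u => Bool.rec false (overlaps P.idx cs u.1 u.2) (mayOverlap P.size cs u.1 u.2))
    P.shared

/-- Match the edges `EB` with the edges `EA` in all possible ways, and check that each way leads to
coinciding points or to a large overlap. -/
def search (P : Params) (n : ℕ) : List Column → List Edge → List Edge → Bool :=
  Nat.rec (fun _ _ _ => false) (fun _ ih cs EA EB => withColumns (clean cs) fun cs =>
    Bool.rec (Bool.rec
      (withCodes (mapOf (fun f => (f, code cs f)) EA) fun EA =>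
        cancel cs (fun EA EB => List.rec false (fun e EB _ =>
          branch (fun f EA => Bool.rec false
            (ih (impose P.primes (fun v => Int.add (diff v e) (diff v f)) cs) EA EB)
            (ih (impose P.primes (fun v => Int.sub (diff v e) (diff v f)) cs) EA EB)) EA [])
          EB.reverse) EA EB [])
      true (finished P cs))
      true (degenerate P.size cs)) n

end

/-! ### Specification of the primitives -/

variable {α β : Type}

@[simp] theorem anyOf_eq (p : α → Bool) (l : List α) : anyOf p l = l.any p := by
  induction l with
  | nil => rfl
  | cons x l ih =>
    change (Bool.rec (anyOf p l) true (p x) : Bool) = _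
    cases h : p x <;> simp [h, ih]

@[simp] theorem allOf_eq (p : α → Bool) (l : List α) : allOf p l = l.all p := by
  induction l with
  | nil => rfl
  | cons x l ih =>
    change (Bool.rec false (allOf p l) (p x) : Bool) = _
    cases h : p x <;> simp [h, ih]

@[simp] theorem mapOf_eq (f : α → β) (l : List α) : mapOf f l = l.map f := by
  induction l with
  | nil => rfl
  | cons x l ih =>
    change f x :: mapOf f l = _
    simp [ih]

@[simp] theorem filterOf_eq (p : α → Bool) (l : List α) : filterOf p l = l.filter p := by
  induction l with
  | nil => rfl
  | cons x l ih =>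
    change (Bool.rec (filterOf p l) (x :: filterOf p l) (p x) : List α) = _
    cases h : p x <;> simp [h, ih]

@[simp] theorem withNat_eq (x : ℕ) (k : ℕ → α) : withNat x k = k x := by
  cases x <;> rfl

@[simp] theorem withInt_eq (x : ℤ) (k : ℤ → α) : withInt x k = k x := by
  cases x with
  | ofNat x => exact withNat_eq x fun n => k (Int.ofNat n)
  | negSucc x => exact withNat_eq x fun n => k (Int.negSucc n)

@[simp] theorem withInts_eq (l : List ℤ) (k : List ℤ → α) : withInts l k = k l := by
  induction l generalizing k with
  | nil => rfl
  | cons x l ih =>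
    change withInt x (fun x => withInts l fun l => k (x :: l)) = _
    simp [ih]

@[simp] theorem withColumns_eq (l : List Column) (k : List Column → α) :
    withColumns l k = k l := by
  induction l generalizing k with
  | nil => rfl
  | cons c l ih =>
    change withNat c.1 (fun m => withInts c.2 fun v => withColumns l fun l => k ((m, v) :: l)) = _
    simp [ih]

@[simp] theorem withVectors_eq (l : List (List ℤ)) (k : List (List ℤ) → α) :
    withVectors l k = k l := by
  induction l generalizing k with
  | nil => rfl
  | cons c l ih =>
    change withInts c (fun v => withVectors l fun l => k (v :: l)) = _
    simp [ih]

@[simp] theorem withCodes_eq (l : List (Edge × ℕ)) (k : List (Edge × ℕ) → α) :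
    withCodes l k = k l := by
  induction l generalizing k with
  | nil => rfl
  | cons c l ih =>
    change withNat c.2 (fun v => withNat c.1.1 fun i => withNat c.1.2 fun j =>
      withCodes l fun l => k (((i, j), v) :: l)) = _
    simp [ih]

@[simp] theorem isZero_iff (x : ℤ) : isZero x = true ↔ x = 0 := by
  cases x with
  | ofNat n =>
    change Nat.beq n 0 = true ↔ _
    rw [Nat.beq_eq]; simp
  | negSucc n => simp [isZero]

@[simp] theorem nth_nil (n : ℕ) : nth [] n = 0 := rfl
@[simp] theorem nth_zero (x : ℤ) (l : List ℤ) : nth (x :: l) 0 = x := rfl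
@[simp] theorem nth_succ (x : ℤ) (l : List ℤ) (n : ℕ) : nth (x :: l) (n + 1) = nth l n := rfl

theorem nth_map (f : ℤ → ℤ) (hf : f 0 = 0) (l : List ℤ) (n : ℕ) :
    nth (l.map f) n = f (nth l n) := by
  induction l generalizing n with
  | nil => simp [hf]
  | cons x l ih => cases n <;> simp [ih]

@[simp] theorem nth_lin (x y : ℤ) (v w : List ℤ) (n : ℕ) :
    nth (lin x y v w) n = x * nth v n + y * nth w n := by
  induction v generalizing w n with
  | nil =>
    change nth (mapOf (fun b => y * b) w) n = _
    rw [mapOf_eq, nth_map _ (by simp)]; simp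
  | cons a v ih =>
    cases w with
    | nil =>
      change nth (mapOf (fun b => x * b) (a :: v)) n = _
      rw [mapOf_eq, nth_map _ (by simp)]; simp
    | cons b w =>
      change nth ((x * a + y * b) :: lin x y v w) n = _
      cases n <;> simp [ih]

theorem modulo_eq (x : ℤ) (m : ℕ) : modulo x m = x % (m : ℤ) := by
  unfold modulo
  cases m with
  | zero => simp
  | succ m => rfl

@[simp] theorem sameInt_iff (x y : ℤ) : sameInt x y = true ↔ x = y := by
  cases x <;> cases y <;> simp [sameInt]

@[simp] theorem sameVector_iff (v w : List ℤ) : sameVector v w = true ↔ v = w := by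
  induction v generalizing w with
  | nil => cases w <;> simp [sameVector]
  | cons a v ih =>
    cases w with
    | nil => simp [sameVector]
    | cons b w =>
      change (Bool.rec false (sameVector v w) (sameInt a b) : Bool) = true ↔ _
      cases h : sameInt a b
      · have : a ≠ b := fun e => by simp [(sameInt_iff a b).2 e] at h
        simp [this]
      · have : a = b := (sameInt_iff a b).1 h
        simp [this, ih]

theorem countVector_eq (x : List ℤ) (l : List (List ℤ)) :
    countVector x l = l.countP (sameVector x) := by
  induction l with
  | nil => rfl
  | cons y l ih =>
    change (Bool.rec (countVector x l) (countVector x l).succ (sameVector x y) : ℕ) = _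
    cases h : sameVector x y <;> simp [h, ih]

theorem split_cons (L : List ℤ → ℤ) (c : Column) (cs : List Column) :
    split L (c :: cs) = if c.1 = 0 then
      ((merge (L c.2) (L (split L cs).1) c.2 (split L cs).1).1,
        (0, (merge (L c.2) (L (split L cs).1) c.2 (split L cs).1).2) :: (split L cs).2)
      else ((split L cs).1, c :: (split L cs).2) := by
  change (Bool.rec ((split L cs).1, c :: (split L cs).2)
      (withInt (L c.2) fun a => withInt (L (split L cs).1) fun b =>
        ((merge a b c.2 (split L cs).1).1,
          ((0, (merge a b c.2 (split L cs).1).2) : Column) ::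
          (split L cs).2)) (Nat.beq c.1 0) : List ℤ × List Column) = _
  cases h : Nat.beq c.1 0
  · have : c.1 ≠ 0 := fun e => by simp [e] at h
    rw [if_neg this]
  · have : c.1 = 0 := by simpa using h
    rw [if_pos this]
    simp only [withInt_eq]

/-- The unimodularity test is part of `merge`, so nothing about `bezout` has to be proved. -/
theorem merge_cases (a b : ℤ) (v w : List ℤ) : merge a b v w = (v, w) ∨
    ∃ x y s t : ℤ, x * s + y * t = 1 ∧ merge a b v w = (lin x y v w, lin (-t) s v w) := by
  unfold merge
  cases isZero b
  · simp only [withInt_eq]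
    generalize bezout 20 a b = q
    obtain ⟨x, y⟩ := q
    simp only
    generalize hs : Int.ediv a _ = s
    generalize ht : Int.ediv b _ = t
    cases h : isZero (Int.sub (Int.add (Int.mul x s) (Int.mul y t)) 1)
    · simp
    · right
      refine ⟨x, y, s, t, ?_, rfl⟩
      rw [isZero_iff] at h
      have : x * s + y * t - 1 = 0 := h
      linarith
  · simp

theorem reduceBy_eq (L : List ℤ → ℤ) (g : ℤ) (w : List ℤ) (c : Column) :
    reduceBy L g w c = c ∨ ∃ q, reduceBy L g w c = (c.1, lin 1 (-q) c.2 w) := by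
  unfold reduceBy
  cases Nat.beq c.1 0
  · exact Or.inr ⟨_, withInt_eq _ _⟩
  · exact Or.inl rfl

/-! ### Submodules described by columns -/

variable (n : ℕ)

/-- The residues of the coordinates of an integer vector. -/
def vec (v : List ℤ) : ℕ → ZMod n := fun i => (nth v i : ℤ)

@[simp] theorem vec_lin (x y : ℤ) (v w : List ℤ) :
    vec n (lin x y v w) = (x : ZMod n) • vec n v + (y : ZMod n) • vec n w := by
  ext i; simp [vec]

/-- The multiples of a column. -/
def columnSpan (c : Column) : Submodule (ZMod n) (ℕ → ZMod n) where
  carrier := {p | ∃ t : ZMod n, (c.1 : ZMod n) * t = 0 ∧ p = t • vec n c.2}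
  zero_mem' := ⟨0, by simp⟩
  add_mem' := by
    rintro p q ⟨t, ht, rfl⟩ ⟨s, hs, rfl⟩
    exact ⟨t + s, by rw [mul_add, ht, hs, add_zero], (add_smul _ _ _).symm⟩
  smul_mem' := by
    rintro a p ⟨t, ht, rfl⟩
    exact ⟨a * t, by rw [mul_left_comm, ht, mul_zero], (mul_smul _ _ _).symm⟩

def span (cs : List Column) : Submodule (ZMod n) (ℕ → ZMod n) := ⨆ c ∈ cs, columnSpan n c

variable {n}

theorem smul_vec_mem {m : ℕ} {t : ZMod n} (h : (m : ZMod n) * t = 0) (v : List ℤ) :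
    t • vec n v ∈ columnSpan n (m, v) := ⟨t, h, rfl⟩

theorem smul_vec_mem_free (t : ZMod n) (v : List ℤ) : t • vec n v ∈ columnSpan n (0, v) :=
  smul_vec_mem (by simp) v

theorem columnSpan_le_span {c : Column} {cs : List Column} (h : c ∈ cs) :
    columnSpan n c ≤ span n cs := le_iSup₂ (f := fun c (_ : c ∈ cs) => columnSpan n c) c h

theorem span_le {cs : List Column} {H : Submodule (ZMod n) (ℕ → ZMod n)}
    (h : ∀ c ∈ cs, columnSpan n c ≤ H) : span n cs ≤ H := iSup₂_le h

theorem span_mono {cs ds : List Column} (h : ∀ c ∈ cs, c ∈ ds) : span n cs ≤ span n ds :=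
  span_le fun c hc => columnSpan_le_span (h c hc)

theorem span_cons (c : Column) (cs : List Column) :
    span n (c :: cs) = columnSpan n c ⊔ span n cs := by
  apply le_antisymm
  · apply span_le
    intro d hd
    rcases List.mem_cons.1 hd with rfl | hd
    · exact le_sup_left
    · exact (columnSpan_le_span hd).trans le_sup_right
  · exact sup_le (columnSpan_le_span (by simp)) (span_mono (by simp +contextual))

@[simp] theorem span_nil : span n [] = ⊥ := by simp [span]

theorem span_map_le {f : Column → Column} {cs : List Column}
    {H : Submodule (ZMod n) (ℕ → ZMod n)}
    (h : ∀ c ∈ cs, columnSpan n c ≤ H ⊔ columnSpan n (f c)) :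
    span n cs ≤ H ⊔ span n (cs.map f) :=
  span_le fun c hc => (h c hc).trans
    (sup_le_sup_left (columnSpan_le_span (List.mem_map_of_mem hc)) _)

theorem span_filter_sup (q : Column → Bool) (cs : List Column) :
    span n cs ≤ span n (cs.filter q) ⊔ span n (cs.filter fun c => !q c) := by
  apply span_le
  intro c hc
  cases h : q c
  · exact (columnSpan_le_span (by simp [hc, h])).trans le_sup_right
  · exact (columnSpan_le_span (by simp [hc, h])).trans le_sup_left

/-- The change of vectors has determinant x s + y t = 1, and its inverse recovers v and w. -/
theorem columnSpan_merge_le (a b : ℤ) (v w : List ℤ) :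
    columnSpan n (0, v) ⊔ columnSpan n (0, w) ≤
      columnSpan n (0, (merge a b v w).1) ⊔ columnSpan n (0, (merge a b v w).2) := by
  rcases merge_cases a b v w with h | ⟨x, y, s, t, hd, h⟩
  · rw [h]
  · rw [h]
    have hd' : (x : ZMod n) * s + y * t = 1 := by exact_mod_cast congrArg (Int.cast (R := ZMod n)) hd
    apply sup_le
    · rintro _ ⟨r, -, rfl⟩
      have : r • vec n v = (r * s) • vec n (lin x y v w) + (-(r * y)) • vec n (lin (-t) s v w) := by
        ext i
        simp only [vec_lin, Pi.add_apply, Pi.smul_apply, smul_eq_mul, Int.cast_neg]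
        linear_combination (-(r * vec n v i)) * hd'
      simp only at this ⊢
      rw [this]
      exact Submodule.add_mem_sup (smul_vec_mem_free _ _) (smul_vec_mem_free _ _)
    · rintro _ ⟨r, -, rfl⟩
      have : r • vec n w = (r * t) • vec n (lin x y v w) + (r * x) • vec n (lin (-t) s v w) := by
        ext i
        simp only [vec_lin, Pi.add_apply, Pi.smul_apply, smul_eq_mul, Int.cast_neg]
        linear_combination (-(r * vec n w i)) * hd'
      simp only at this ⊢
      rw [this]
      exact Submodule.add_mem_sup (smul_vec_mem_free _ _) (smul_vec_mem_free _ _)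

theorem span_split_le (L : List ℤ → ℤ) (cs : List Column) :
    span n cs ≤ columnSpan n (0, (split L cs).1) ⊔ span n (split L cs).2 := by
  induction cs with
  | nil => simp
  | cons c cs ih =>
    rw [span_cons, split_cons]
    split_ifs with h
    · simp only [span_cons]
      have hc : c = (0, c.2) := Prod.ext h rfl
      rw [← sup_assoc]
      refine (sup_le_sup_left ih _).trans ?_
      rw [← sup_assoc]
      refine sup_le_sup_right ?_ _
      conv_lhs => rw [hc]
      exact columnSpan_merge_le _ _ _ _
    · simp only [span_cons]
      rw [sup_left_comm]
      exact sup_le_sup_left ih _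

theorem columnSpan_reduceBy_le (L : List ℤ → ℤ) (g : ℤ) (w : List ℤ) (c : Column) :
    columnSpan n c ≤ columnSpan n (0, w) ⊔ columnSpan n (reduceBy L g w c) := by
  rcases reduceBy_eq L g w c with h | ⟨q, h⟩
  · rw [h]; exact le_sup_right
  · rw [h]
    rintro _ ⟨t, ht, rfl⟩
    have : t • vec n c.2 = (t * q) • vec n w + t • vec n (lin 1 (-q) c.2 w) := by
      ext i
      simp only [vec_lin, Pi.add_apply, Pi.smul_apply, smul_eq_mul, Int.cast_neg, Int.cast_one]
      ring
    rw [this]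
    exact Submodule.add_mem_sup (smul_vec_mem_free _ _) (smul_vec_mem ht _)

theorem stripPrime_spec {p : ℕ} (hp : IsUnit (p : ZMod n)) (k g : ℕ) :
    ∃ u : (ZMod n)ˣ, (g : ZMod n) = u * (stripPrime p k g : ℕ) := by
  induction k generalizing g with
  | zero => exact ⟨1, by simp [stripPrime]⟩
  | succ k ih =>
    change ∃ u : (ZMod n)ˣ, (g : ZMod n) =
      u * ((Bool.rec g (stripPrime p k (g / p)) (Nat.beq (g % p) 0) : ℕ) : ZMod n)
    cases h : Nat.beq (g % p) 0
    · exact ⟨1, by simp⟩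
    · obtain ⟨u, hu⟩ := ih (g / p)
      obtain ⟨v, hv⟩ := hp
      refine ⟨v * u, ?_⟩
      have h0 : g % p = 0 := by simpa using h
      have : g = p * (g / p) := (Nat.mul_div_cancel' (Nat.dvd_of_mod_eq_zero h0)).symm
      conv_lhs => rw [this]
      rw [Nat.cast_mul, hu, ← hv, Units.val_mul, mul_assoc]

theorem strip_spec {ps : List ℕ} (hps : ∀ p ∈ ps, IsUnit (p : ZMod n)) (g : ℤ) :
    ∃ u : (ZMod n)ˣ, (g : ZMod n) = u * (strip ps g.natAbs : ℕ) := by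
  have key : ∀ g : ℕ, ∃ u : (ZMod n)ˣ, (g : ZMod n) = u * (strip ps g : ℕ) := by
    intro g
    induction ps with
    | nil => exact ⟨1, by simp [strip]⟩
    | cons p ps ih =>
      obtain ⟨u, hu⟩ := ih fun q hq => hps q (by simp [hq])
      obtain ⟨v, hv⟩ := stripPrime_spec (hps p (by simp)) 8 (strip ps g)
      refine ⟨u * v, ?_⟩
      change _ = _ * ((stripPrime p 8 (strip ps g) : ℕ) : ZMod n)
      rw [hu, hv, Units.val_mul, mul_assoc]
  obtain ⟨u, hu⟩ := key g.natAbs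
  rcases Int.natAbs_eq g with h | h
  · have := congrArg (Int.cast (R := ZMod n)) h
    exact ⟨u, by rw [← hu, this, Int.cast_natCast]⟩
  · have := congrArg (Int.cast (R := ZMod n)) h
    exact ⟨-u, by rw [Units.val_neg, neg_mul, ← hu, this, Int.cast_neg, Int.cast_natCast]⟩

theorem strip_mul_eq_zero {ps : List ℕ} (hps : ∀ p ∈ ps, IsUnit (p : ZMod n)) {g : ℤ}
    {s : ZMod n} (h : (g : ZMod n) * s = 0) : ((strip ps g.natAbs : ℕ) : ZMod n) * s = 0 := by
  obtain ⟨u, hu⟩ := strip_spec hps g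
  rw [hu, mul_assoc] at h
  simpa using h

/-! ### Soundness of imposing a relation -/

/-- `Λ` is the functional on residue vectors with the values `L` on integer vectors. -/
def Represents (L : List ℤ → ℤ) (Λ : (ℕ → ZMod n) →ₗ[ZMod n] ZMod n) : Prop :=
  ∀ v, Λ (vec n v) = (L v : ZMod n)

theorem cast_mul_eq_zero {m : ℕ} {t : ZMod n} (ht : (m : ZMod n) * t = 0) {x : ℤ}
    (hx : x % (m : ℤ) = 0) : t * (x : ZMod n) = 0 := by
  obtain ⟨y, rfl⟩ := Int.dvd_of_emod_eq_zero hx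
  push_cast
  rw [← mul_assoc, mul_comm t, ht, zero_mul]

theorem map_eq_zero_of_not_involved {L : List ℤ → ℤ} {Λ : (ℕ → ZMod n) →ₗ[ZMod n] ZMod n}
    (hL : Represents L Λ) {cs : List Column} (h : ∀ c ∈ cs, L c.2 % (c.1 : ℤ) = 0)
    {p : ℕ → ZMod n} (hp : p ∈ span n cs) : Λ p = 0 := by
  have : span n cs ≤ LinearMap.ker Λ := by
    apply span_le
    rintro c hc _ ⟨t, ht, rfl⟩
    rw [LinearMap.mem_ker, map_smul, hL, smul_eq_mul]
    exact cast_mul_eq_zero ht (h c hc)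
  exact this hp

theorem involved_eq_false {L : List ℤ → ℤ} {c : Column} :
    involved L c = false ↔ L c.2 % (c.1 : ℤ) = 0 := by
  rw [involved, Bool.not_eq_false', isZero_iff, modulo_eq]

theorem inverseMod_spec {c : ℤ} {m k : ℕ} (h : inverseMod c m = some k) :
    (c * k - 1) % (m : ℤ) = 0 := by
  have := List.find?_some h
  exact (isZero_iff _).1 this

theorem prod_smul_eq_zero (cs : List Column) {r : ℕ → ZMod n} (hr : r ∈ span n cs) :
    ((cs.foldr (fun c a => c.1 * a) 1 : ℕ) : ZMod n) • r = 0 := by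
  induction cs generalizing r with
  | nil => rw [span_nil, Submodule.mem_bot] at hr; rw [hr, smul_zero]
  | cons c cs ih =>
    rw [span_cons] at hr
    obtain ⟨_, ⟨t, ht, rfl⟩, q, hq, rfl⟩ := Submodule.mem_sup.1 hr
    rw [List.foldr_cons, Nat.cast_mul, smul_add, mul_smul _ _ q, ih hq, smul_zero, add_zero,
      smul_smul, mul_right_comm, ht, zero_mul, zero_smul]

theorem foldr_mul (cs : List Column) (h : ℕ) :
    cs.foldr (fun c a => c.1 * a) h = cs.foldr (fun c a => c.1 * a) 1 * h := by
  induction cs with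
  | nil => simp
  | cons c cs ih => rw [List.foldr_cons, List.foldr_cons, ih, mul_assoc]

theorem exists_involved {L : List ℤ → ℤ} {Λ : (ℕ → ZMod n) →ₗ[ZMod n] ZMod n}
    (hL : Represents L Λ) {out : List Column} {r : ℕ → ZMod n} (hr : r ∈ span n out) :
    ∃ x ∈ span n (out.filter (involved L)), ∃ y ∈ span n (out.filter fun c => !involved L c),
      x + y = r ∧ Λ y = 0 := by
  obtain ⟨x, hx, y, hy, rfl⟩ := Submodule.mem_sup.1 (span_filter_sup (involved L) out hr)
  refine ⟨x, hx, y, hy, rfl, map_eq_zero_of_not_involved hL (fun c hc => ?_) hy⟩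
  have := List.of_mem_filter hc
  exact involved_eq_false.1 (by simpa using this)

/-- The map T = g · id - Λ(·) w sends each old column into the corresponding new one. The relation
gives T r = g (s w + r), and g is invertible. -/
theorem mem_span_of_isUnit {L : List ℤ → ℤ} {Λ : (ℕ → ZMod n) →ₗ[ZMod n] ZMod n}
    (hL : Represents L Λ) {w : List ℤ} {out : List Column} {g : ℤ} (hg : IsUnit (g : ZMod n))
    {s : ZMod n} {r : ℕ → ZMod n} (hr : r ∈ span n out) (h : s * g + Λ r = 0) :
    s • vec n w + r ∈ span n (out.map fun c => (c.1, lin g (Int.neg (L c.2)) c.2 w)) := by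
  set ds := out.map fun c : Column => ((c.1, lin g (Int.neg (L c.2)) c.2 w) : Column)
  let T : (ℕ → ZMod n) →ₗ[ZMod n] (ℕ → ZMod n) :=
    (g : ZMod n) • LinearMap.id - Λ.smulRight (vec n w)
  have key : span n out ≤ (span n ds).comap T := by
    apply span_le
    rintro c hc _ ⟨t, ht, rfl⟩
    refine columnSpan_le_span (List.mem_map_of_mem hc) ⟨t, ht, ?_⟩
    have : (Int.neg (L c.2) : ZMod n) = - (L c.2 : ZMod n) := Int.cast_neg _
    simp only [T, vec_lin, LinearMap.sub_apply, LinearMap.smul_apply, LinearMap.id_apply,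
      LinearMap.smulRight_apply, map_smul, hL c.2, this]
    ext i
    simp only [Pi.add_apply, Pi.sub_apply, Pi.smul_apply, smul_eq_mul]
    ring
  obtain ⟨u, hu⟩ := hg
  have hT : T r ∈ span n ds := key hr
  have : s • vec n w + r = (↑u⁻¹ : ZMod n) • T r := by
    have h1 : Λ r = - (s * u) := by rw [hu]; linear_combination h
    have h2 : (↑u⁻¹ : ZMod n) * u = 1 := u.inv_mul
    ext i
    simp only [T, LinearMap.sub_apply, LinearMap.smul_apply, LinearMap.id_apply, ← hu,
      LinearMap.smulRight_apply, h1, Pi.add_apply, Pi.sub_apply, Pi.smul_apply, smul_eq_mul]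
    linear_combination (-(s * vec n w i + r i)) * h2
  rw [this]
  exact Submodule.smul_mem _ _ hT

theorem gcd_mul_eq_zero {a b : ℕ} {t : ZMod n} (ha : (a : ZMod n) * t = 0)
    (hb : (b : ZMod n) * t = 0) : ((Nat.gcd a b : ℕ) : ZMod n) * t = 0 := by
  have := congrArg (Int.cast (R := ZMod n)) (Nat.gcd_eq_gcd_ab a b)
  push_cast at this
  rw [this, add_mul, mul_right_comm, ha, mul_right_comm, hb, zero_mul, zero_mul, add_zero]

theorem smul_add_mem_span_cons {m : ℕ} {s : ZMod n} (hs : (m : ZMod n) * s = 0) (w : List ℤ)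
    {out : List Column} {r : ℕ → ZMod n} (hr : r ∈ span n out) :
    s • vec n w + r ∈ span n ((m, w) :: out) := by
  rw [span_cons]
  exact Submodule.add_mem_sup (smul_vec_mem hs w) hr

/-- Only the part x of r in the involved columns contributes to Λ. The product of their moduli kills
Λ x, hence, together with the essential part of L w, kills s; the cases of `impose₀` refine this
bound. -/
theorem mem_span_impose₀ {ps : List ℕ} (hps : ∀ p ∈ ps, IsUnit (p : ZMod n))
    {L : List ℤ → ℤ} {Λ : (ℕ → ZMod n) →ₗ[ZMod n] ZMod n}
    (hL : Represents L Λ) {w : List ℤ} {out : List Column}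
    {s : ZMod n} {r : ℕ → ZMod n} (hr : r ∈ span n out) (h : s * (L w : ZMod n) + Λ r = 0) :
    s • vec n w + r ∈ span n (impose₀ ps L w out (L w) (strip ps (L w).natAbs)) := by
  obtain ⟨x, hx, y, hy, hxy, hΛy⟩ := exists_involved hL hr
  have hΛ : Λ r = Λ x := by rw [← hxy, map_add, hΛy, add_zero]
  have hunit : Nat.beq (strip ps (L w).natAbs) 1 = true → IsUnit (L w : ZMod n) := by
    intro h1
    obtain ⟨u, hu⟩ := strip_spec hps (L w)
    rw [Nat.eq_of_beq_eq_true h1] at hu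
    exact ⟨u, by simpa using hu.symm⟩
  have hprod : (((out.filter (involved L)).foldr (fun c a => c.1 * a) (strip ps (L w).natAbs) : ℕ) :
      ZMod n) * s = 0 := by
    have h0 : (((out.filter (involved L)).foldr (fun c a => c.1 * a) 1 : ℕ) : ZMod n) * Λ x = 0 := by
      rw [← smul_eq_mul, ← map_smul, prod_smul_eq_zero _ hx, map_zero]
    rw [foldr_mul, Nat.cast_mul, mul_right_comm, mul_comm]
    apply strip_mul_eq_zero hps
    rw [hΛ] at h
    linear_combination ((((out.filter (involved L)).foldr (fun c a => c.1 * a) 1 : ℕ) : ZMod n)) * h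
      - h0
  unfold impose₀
  simp only [filterOf_eq, mapOf_eq]
  split
  · next hnil =>
    rw [hnil] at hx hprod
    simp only [List.foldr_nil] at hprod
    cases h1 : Nat.beq (strip ps (L w).natAbs) 1
    · exact smul_add_mem_span_cons hprod w hr
    · rw [Nat.eq_of_beq_eq_true h1, Nat.cast_one, one_mul] at hprod
      rw [hprod, zero_smul, zero_add]
      exact hr
  · next m v hone =>
    cases h1 : Nat.beq (strip ps (L w).natAbs) 1
    · rw [hone] at hx hprod
      rw [span_cons, span_nil, sup_bot_eq] at hx
      obtain ⟨t, ht, hxt⟩ := hx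
      simp only at hxt ht
      have hΛx : Λ x = t * (L v : ZMod n) := by rw [hxt, map_smul, hL, smul_eq_mul]
      cases h2 : isZero (L w)
      · simp only
        split
        · next k hk =>
          have hk' := inverseMod_spec hk
          have h3 := cast_mul_eq_zero ht hk'
          push_cast at h3
          have h4 : t = -(k * (L w : ZMod n)) * s := by
            rw [hΛ, hΛx] at h
            linear_combination (k : ZMod n) * h - h3
          have : s • vec n w + r = s • vec n (lin 1 (-(k * L w)) w v) + y := by
            rw [← hxy, hxt]
            ext i
            simp only [vec_lin, Pi.add_apply, Pi.smul_apply, smul_eq_mul, Int.cast_neg,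
              Int.cast_one, Int.cast_mul, Int.cast_natCast]
            linear_combination vec n v i * h4
          rw [this]
          refine smul_add_mem_span_cons ?_ _ hy
          simpa [mul_comm] using hprod
        · refine smul_add_mem_span_cons ?_ _ hr
          simpa using hprod
      · simp only
        rw [← hxy, hxt]
        refine smul_add_mem_span_cons (by simp) _ (smul_add_mem_span_cons ?_ _ hy)
        refine gcd_mul_eq_zero ht (strip_mul_eq_zero hps ?_)
        rw [isZero_iff] at h2
        rw [mul_comm, ← hΛx, ← hΛ]
        simpa [h2] using h
    · exact mem_span_of_isUnit hL (hunit h1) hr h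
  · cases h1 : Nat.beq (strip ps (L w).natAbs) 1
    · exact smul_add_mem_span_cons hprod w hr
    · exact mem_span_of_isUnit hL (hunit h1) hr h

theorem mem_span_impose {ps : List ℕ} (hps : ∀ p ∈ ps, IsUnit (p : ZMod n))
    {L : List ℤ → ℤ} {Λ : (ℕ → ZMod n) →ₗ[ZMod n] ZMod n}
    (hL : Represents L Λ) {cs : List Column} {p : ℕ → ZMod n} (hp : p ∈ span n cs)
    (h : Λ p = 0) : p ∈ span n (impose ps L cs) := by
  have hp := span_split_le L cs hp
  unfold impose
  generalize split L cs = q at hp ⊢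
  obtain ⟨w, out⟩ := q
  simp only [withInt_eq, withNat_eq, mapOf_eq] at hp ⊢
  have : columnSpan n (0, w) ⊔ span n out ≤
      columnSpan n (0, w) ⊔ span n (out.map (reduceBy L (L w) w)) :=
    sup_le le_sup_left (span_map_le fun c _ => columnSpan_reduceBy_le L (L w) w c)
  obtain ⟨_, ⟨s, -, rfl⟩, r, hr, rfl⟩ := Submodule.mem_sup.1 (this hp)
  refine mem_span_impose₀ hps hL hr ?_
  rw [map_add, map_smul, hL, smul_eq_mul] at h
  exact h

theorem allOf_isZero_iff (v : List ℤ) : v.all isZero = true ↔ ∀ x ∈ v, x = 0 := by simp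

theorem nth_eq_zero {v : List ℤ} (h : ∀ x ∈ v, x = 0) (i : ℕ) : nth v i = 0 := by
  induction v generalizing i with
  | nil => rfl
  | cons x v ih =>
    cases i with
    | zero => exact h x (by simp)
    | succ i => exact ih (fun y hy => h y (by simp [hy])) i

theorem columnSpan_tidy (c : Column) : columnSpan n c ≤ columnSpan n (tidy c) := by
  unfold tidy
  cases Nat.beq c.1 0
  · rintro _ ⟨t, ht, rfl⟩
    refine ⟨t, ht, ?_⟩
    ext i
    have h := Int.emod_add_mul_ediv (nth c.2 i) c.1
    have h := congrArg (Int.cast (R := ZMod n)) h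
    simp only [mapOf_eq, modulo_eq, Pi.smul_apply, smul_eq_mul, vec]
    rw [nth_map (fun x => x % (c.1 : ℤ)) (by simp), ← h]
    push_cast
    linear_combination (nth c.2 i / (c.1 : ℤ) : ℤ) * ht
  · exact le_rfl

theorem span_clean (cs : List Column) : span n cs ≤ span n (clean cs) := by
  rw [clean, filterOf_eq, mapOf_eq]
  refine (span_le fun c hc => (columnSpan_tidy c).trans
    (columnSpan_le_span (List.mem_map_of_mem hc)) : _ ≤ span n (cs.map tidy)).trans ?_
  apply span_le
  intro c hc
  cases h : relevant c
  · rintro _ ⟨t, ht, rfl⟩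
    suffices t • vec n c.2 = 0 by rw [this]; exact zero_mem _
    unfold relevant at h
    cases h1 : Nat.beq c.1 1
    · rw [h1] at h
      simp only [allOf_eq, Bool.not_eq_false'] at h
      have h2 := nth_eq_zero ((allOf_isZero_iff _).1 h)
      ext i
      simp [vec, h2]
    · rw [Nat.eq_of_beq_eq_true h1, Nat.cast_one, one_mul] at ht
      rw [ht, zero_smul]
  · exact columnSpan_le_span (List.mem_filter.2 ⟨hc, h⟩)

/-! ### Soundness of the tests and of the search -/

theorem represents_proj (i : ℕ) :
    Represents (n := n) (fun v => nth v i) (LinearMap.proj (R := ZMod n) (φ := fun _ => ZMod n) i) :=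
  fun _ => rfl

theorem Represents.sub {L M : List ℤ → ℤ} {Λ Μ : (ℕ → ZMod n) →ₗ[ZMod n] ZMod n}
    (hL : Represents L Λ) (hM : Represents M Μ) :
    Represents (fun v => Int.sub (L v) (M v)) (Λ - Μ) := fun v => by
  rw [LinearMap.sub_apply, hL, hM]; exact (Int.cast_sub _ _).symm

theorem Represents.add {L M : List ℤ → ℤ} {Λ Μ : (ℕ → ZMod n) →ₗ[ZMod n] ZMod n}
    (hL : Represents L Λ) (hM : Represents M Μ) :
    Represents (fun v => Int.add (L v) (M v)) (Λ + Μ) := fun v => by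
  rw [LinearMap.add_apply, hL, hM]; exact (Int.cast_add _ _).symm

theorem Represents.mul (u : ℤ) {L : List ℤ → ℤ} {Λ : (ℕ → ZMod n) →ₗ[ZMod n] ZMod n}
    (hL : Represents L Λ) :
    Represents (fun v => Int.mul u (L v)) ((u : ZMod n) • Λ) := fun v => by
  rw [LinearMap.smul_apply, hL]; exact (Int.cast_mul _ _).symm

variable (n) in
/-- The difference along an edge. -/
def edgeMap (e : Edge) : (ℕ → ZMod n) →ₗ[ZMod n] ZMod n :=
  LinearMap.proj (R := ZMod n) (φ := fun _ => ZMod n) e.1 - LinearMap.proj e.2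

theorem represents_diff (e : Edge) : Represents (fun v => diff v e) (edgeMap n e) :=
  (represents_proj e.1).sub (represents_proj e.2)

/-- The difference along an edge up to sign. -/
def absDiff (p : ℕ → ZMod n) (e : Edge) : Sym2 (ZMod n) := s(p e.1 - p e.2, -(p e.1 - p e.2))

theorem absDiff_eq_iff {p : ℕ → ZMod n} {e f : Edge} : absDiff p e = absDiff p f ↔
    edgeMap n e p - edgeMap n f p = 0 ∨ edgeMap n e p + edgeMap n f p = 0 := by
  change s(edgeMap n e p, -(edgeMap n e p)) = s(edgeMap n f p, -(edgeMap n f p)) ↔ _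
  rw [Sym2.eq_iff, sub_eq_zero, add_eq_zero_iff_eq_neg]
  constructor
  · rintro (h | h)
    · exact Or.inl h.1
    · exact Or.inr h.1
  · rintro (h | h)
    · exact Or.inl ⟨h, by rw [h]⟩
    · exact Or.inr ⟨h, by rw [h, neg_neg]⟩

theorem map_eq_zero_of_vanishes {L : List ℤ → ℤ} {Λ : (ℕ → ZMod n) →ₗ[ZMod n] ZMod n}
    (hL : Represents L Λ) {cs : List Column} (h : vanishes cs L = true)
    {p : ℕ → ZMod n} (hp : p ∈ span n cs) : Λ p = 0 := by
  refine map_eq_zero_of_not_involved hL (fun c hc => ?_) hp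
  rw [vanishes, allOf_eq, List.all_eq_true] at h
  have := h c hc
  rwa [isZero_iff, modulo_eq] at this

theorem absDiff_eq_of_agree {cs : List Column} {e f : Edge} (h : agree cs e f = true)
    {p : ℕ → ZMod n} (hp : p ∈ span n cs) : absDiff p e = absDiff p f := by
  rw [absDiff_eq_iff]
  unfold agree at h
  cases h1 : vanishes cs fun v => Int.sub (diff v e) (diff v f)
  · rw [h1] at h
    exact Or.inr (map_eq_zero_of_vanishes ((represents_diff e).add (represents_diff f)) h hp)
  · exact Or.inl (map_eq_zero_of_vanishes ((represents_diff e).sub (represents_diff f)) h1 hp)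

/-- The codes only filter candidates; the conclusion comes from `agree` alone. -/
theorem take?_spec {cs : List Column} {e : Edge} {k : ℕ} {l r : List (Edge × ℕ)}
    (h : take? cs e k l = some r) :
    ∃ f, agree cs e f = true ∧ (l.map Prod.fst).Perm (f :: r.map Prod.fst) := by
  induction l generalizing r with
  | nil => exact absurd h (by simp [take?])
  | cons f l ih =>
    change (Bool.rec (Option.rec none (fun r => some (f :: r)) (take? cs e k l)) (some l)
      (Bool.rec false (agree cs e f.1) (Nat.beq k f.2) : Bool) : Option _) = some r at h
    cases h1 : (Bool.rec false (agree cs e f.1) (Nat.beq k f.2) : Bool)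
    · rw [h1] at h
      cases h2 : take? cs e k l with
      | none => rw [h2] at h; simp at h
      | some q =>
        rw [h2] at h
        obtain rfl : f :: q = r := by simpa using h
        obtain ⟨g, hg, hp⟩ := ih h2
        exact ⟨g, hg, (hp.cons f.1).trans (List.Perm.swap _ _ _)⟩
    · rw [h1] at h
      obtain rfl : l = r := by simpa using h
      refine ⟨f.1, ?_, by simp⟩
      cases h2 : Nat.beq k f.2
      · rw [h2] at h1; simp at h1
      · rw [h2] at h1; exact h1

/-- Edges that agree on the whole submodule have equal differences up to sign at p, so removing them
from both sides preserves equality of the multisets. -/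
theorem cancel_spec {cs : List Column} {p : ℕ → ZMod n} (hp : p ∈ span n cs)
    (k : List Edge → List Edge → α) (EB s : List Edge) (EA : List (Edge × ℕ))
    (h : ((EA.map Prod.fst).map (absDiff p)).Perm ((s ++ EB).map (absDiff p))) :
    ∃ EA' s', cancel cs k EA EB s = k EA' s' ∧
      (EA'.map (absDiff p)).Perm (s'.map (absDiff p)) := by
  induction EB generalizing s EA with
  | nil => exact ⟨EA.map Prod.fst, s, by simp [cancel], by simpa using h⟩
  | cons e EB ih =>
    change ∃ EA' s', withNat (code cs e) (fun m => (Option.rec (cancel cs k EA EB (e :: s))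
      (fun r => cancel cs k r EB s) (take? cs e m EA) : α)) = k EA' s' ∧ _
    rw [withNat_eq]
    have h' : ((EA.map Prod.fst).map (absDiff p)).Perm ((e :: s ++ EB).map (absDiff p)) :=
      h.trans (List.perm_middle.map _)
    cases h1 : take? cs e (code cs e) EA with
    | none => exact ih _ _ h'
    | some r =>
      obtain ⟨f, hf, hperm⟩ := take?_spec h1
      refine ih _ _ (List.Perm.cons_inv (a := absDiff p e) ?_)
      refine List.Perm.trans ?_ h'
      rw [absDiff_eq_of_agree hf hp]
      exact (hperm.map (absDiff p)).symm

theorem branch_spec {f : Edge → List Edge → Bool} {l s : List Edge} (h : branch f l s = true)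
    {e : Edge} (he : e ∈ l) : ∃ r, f e r = true ∧ (s ++ l).Perm (e :: r) := by
  induction l generalizing s with
  | nil => simp at he
  | cons d l ih =>
    change (Bool.rec false (branch f l (d :: s)) (f d (s ++ l)) : Bool) = true at h
    cases h1 : f d (s ++ l)
    · rw [h1] at h; simp at h
    · rw [h1] at h
      rcases List.mem_cons.1 he with rfl | he
      · exact ⟨s ++ l, h1, List.perm_middle⟩
      · obtain ⟨r, hr, hperm⟩ := ih h he
        exact ⟨r, hr, List.perm_middle.trans hperm⟩

theorem rows_cons (K : ℕ) (c : Column) (cs : List Column) :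
    rows K (c :: cs) = List.zipWith List.cons c.2 (rows K cs) := by
  change (List.rec (fun _ => []) (fun x _ ih' r => List.rec [] (fun y r _ => (x :: y) :: ih' r) r)
      c.2 : List (List ℤ) → List (List ℤ)) (rows K cs) = _
  generalize rows K cs = r
  generalize c.2 = v
  induction v generalizing r with
  | nil => simp
  | cons x v ih =>
    cases r with
    | nil => simp
    | cons y r => simpa using ih r

theorem length_rows_le (K : ℕ) (cs : List Column) : (rows K cs).length ≤ K + K := by
  induction cs with
  | nil => simp [rows]
  | cons c cs ih => rw [rows_cons]; simp; omega

theorem getElem_rows (K : ℕ) (cs : List Column) (i : ℕ) (h : i < (rows K cs).length) :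
    (rows K cs)[i] = cs.map fun c => nth c.2 i := by
  induction cs with
  | nil => simp [rows]
  | cons c cs ih =>
    have h' := h
    simp only [rows_cons, List.length_zipWith, lt_min_iff] at h'
    simp only [rows_cons, List.getElem_zipWith, List.map_cons, ih h'.2]
    congr 1
    have : ∀ (v : List ℤ) (i : ℕ) (h : i < v.length), v[i] = nth v i := by
      intro v
      induction v with
      | nil => intro i h; simp at h
      | cons x v ih =>
        intro i h
        cases i with
        | zero => rfl
        | succ i => simpa using ih i _
    exact this _ _ h'.1

theorem not_nodup_of_repeats {l : List (List ℤ)} (h : repeats l = true) : ¬ l.Nodup := by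
  induction l with
  | nil => simp [repeats] at h
  | cons x l ih =>
    change (Bool.rec (repeats l) true (anyOf (sameVector x) l) : Bool) = true at h
    rw [List.nodup_cons]
    rintro ⟨h1, h2⟩
    cases h3 : anyOf (sameVector x) l
    · rw [h3] at h; exact ih h h2
    · rw [anyOf_eq, List.any_eq_true] at h3
      obtain ⟨y, hy, hxy⟩ := h3
      rw [sameVector_iff] at hxy
      exact h1 (hxy ▸ hy)

theorem eq_of_getElem_rows_eq {K : ℕ} {cs : List Column} {p : ℕ → ZMod n} (hp : p ∈ span n cs)
    {i j : ℕ} (hi : i < (rows K cs).length) (hj : j < (rows K cs).length)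
    (h : (rows K cs)[i] = (rows K cs)[j]) : p i = p j := by
  rw [getElem_rows, getElem_rows, List.map_inj_left] at h
  have := map_eq_zero_of_not_involved ((represents_proj i).sub (represents_proj j))
    (cs := cs) (fun c hc => ?_) hp
  · exact sub_eq_zero.1 this
  · have := h c hc
    change (nth c.2 i - nth c.2 j) % _ = 0
    rw [this, sub_self, Int.zero_emod]

theorem not_degenerate {K : ℕ} {cs : List Column} {p : ℕ → ZMod n} (hp : p ∈ span n cs)
    (hA : Set.InjOn p (Set.Iio K)) (hB : Set.InjOn p (Set.Ico K (K + K))) :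
    degenerate K cs = false := by
  have hA' : ((rows K cs).take K).Nodup := by
    rw [List.nodup_iff_injective_get]
    rintro ⟨i, hi⟩ ⟨j, hj⟩ h
    simp only [List.length_take, lt_min_iff] at hi hj
    simp only [List.get_eq_getElem, List.getElem_take] at h
    exact Fin.ext (hA hi.1 hj.1 (eq_of_getElem_rows_eq hp hi.2 hj.2 h))
  have hB' : ((rows K cs).drop K).Nodup := by
    rw [List.nodup_iff_injective_get]
    rintro ⟨i, hi⟩ ⟨j, hj⟩ h
    have hl := length_rows_le K cs
    simp only [List.length_drop] at hi hj
    simp only [List.get_eq_getElem, List.getElem_drop] at h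
    have := hB (x₁ := K + i) (x₂ := K + j) ⟨by omega, by omega⟩ ⟨by omega, by omega⟩
      (eq_of_getElem_rows_eq hp (by omega) (by omega) h)
    exact Fin.ext (by simpa using this)
  rw [degenerate, withVectors_eq]
  cases h1 : repeats ((rows K cs).take K)
  · cases h2 : repeats ((rows K cs).drop K)
    · rfl
    · exact absurd hB' (not_nodup_of_repeats h2)
  · exact absurd hA' (not_nodup_of_repeats h1)

/-- Pairs whose shifts have the same coordinates modulo every m give the same value of u a - b at
every vector of the submodule. -/
theorem exists_overlap {idx : List Edge} {cs : List Column} {u : ℤ} {c : ℕ}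
    (h : overlaps idx cs u c = true) {p : ℕ → ZMod n} (hp : p ∈ span n cs) :
    ∃ g : ZMod n, c ≤ idx.countP fun e => decide ((u : ZMod n) * p e.1 - p e.2 = g) := by
  rw [overlaps, withVectors_eq, mapOf_eq, anyOf_eq, List.any_eq_true] at h
  obtain ⟨_, hx, h⟩ := h
  obtain ⟨f, -, rfl⟩ := List.mem_map.1 hx
  refine ⟨u * p f.1 - p f.2, (Nat.le_of_ble_eq_true h).trans ?_⟩
  rw [countVector_eq, List.countP_map]
  refine List.countP_mono_left fun e _ he => ?_
  rw [Function.comp_apply, sameVector_iff, shift, shift, mapOf_eq, mapOf_eq,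
    List.map_inj_left] at he
  have hr := fun e : Edge => ((represents_proj (n := n) e.1).mul u).sub (represents_proj e.2)
  have := map_eq_zero_of_not_involved ((hr e).sub (hr f)) (cs := cs) (fun c hc => ?_) hp
  · exact decide_eq_true (sub_eq_zero.1 this)
  · have := he c hc
    rw [modulo_eq, modulo_eq] at this
    exact Int.emod_eq_zero_of_dvd (Int.ModEq.dvd this)

/-- The actual configuration p selects a path in the tree: its first remaining edge of B has some
partner in A with some sign, and p stays in the submodule after this relation is imposed.
Injectivity excludes degenerate leaves, so the path ends at an overlap. -/
theorem search_spec {P : Params} (hP : ∀ q ∈ P.primes, IsUnit (q : ZMod n)) {p : ℕ → ZMod n}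
    (hA : Set.InjOn p (Set.Iio P.size)) (hB : Set.InjOn p (Set.Ico P.size (P.size + P.size)))
    {k : ℕ} {cs : List Column} {EA EB : List Edge} (h : search P k cs EA EB = true)
    (hp : p ∈ span n cs) (hE : (EA.map (absDiff p)).Perm (EB.map (absDiff p))) :
    ∃ x ∈ P.shared, ∃ g : ZMod n,
      x.2 ≤ P.idx.countP fun e => decide ((x.1 : ZMod n) * p e.1 - p e.2 = g) := by
  induction k generalizing cs EA EB with
  | zero => simp [search] at h
  | succ k ih =>
    have hp := span_clean cs hp
    change withColumns (clean cs) (fun cs =>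
      Bool.rec (Bool.rec
      (withCodes (mapOf (fun f => (f, code cs f)) EA) fun EA =>
        cancel cs (fun EA EB => List.rec false (fun e EB _ =>
          branch (fun f EA => Bool.rec false
            (search P k (impose P.primes (fun v => Int.add (diff v e) (diff v f)) cs) EA EB)
            (search P k (impose P.primes (fun v => Int.sub (diff v e) (diff v f)) cs) EA EB))
              EA []) EB.reverse) EA EB [])
      true (finished P cs))
      true (degenerate P.size cs)) = true at h
    rw [withColumns_eq] at h
    generalize clean cs = cs at h hp
    rw [not_degenerate hp hA hB] at h
    cases h1 : finished P cs
    · rw [h1, withCodes_eq, mapOf_eq] at h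
      obtain ⟨EA', s, hk, hE⟩ := cancel_spec hp _ EB [] (EA.map fun f => (f, code cs f))
        (by simpa [Function.comp_def] using hE)
      replace h := hk.symm.trans h
      replace hE := hE.trans ((s.reverse_perm.map (absDiff p)).symm)
      generalize s.reverse = s at h hE
      cases s with
      | nil => simp at h
      | cons e s =>
        have he : absDiff p e ∈ EA'.map (absDiff p) := hE.mem_iff.2 (by simp)
        obtain ⟨f, hf, hef⟩ := List.mem_map.1 he
        obtain ⟨r, hr, hperm⟩ := branch_spec h hf
        have hE' : (r.map (absDiff p)).Perm (s.map (absDiff p)) := by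
          refine List.Perm.cons_inv (a := absDiff p e) ?_
          refine List.Perm.trans ?_ hE
          rw [← hef]
          exact (hperm.map (absDiff p)).symm
        cases h2 : search P k (impose P.primes (fun v => Int.sub (diff v e) (diff v f)) cs) r s
        · simp [h2] at hr
        · simp only [h2] at hr
          rcases absDiff_eq_iff.1 hef.symm with h3 | h3
          · exact ih h2 (mem_span_impose hP ((represents_diff e).sub (represents_diff f)) hp h3) hE'
          · exact ih hr (mem_span_impose hP ((represents_diff e).add (represents_diff f)) hp h3) hE'
    · rw [finished, anyOf_eq, List.any_eq_true] at h1
      obtain ⟨x, hx, h1⟩ := h1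
      refine ⟨x, hx, exists_overlap (?_ : overlaps P.idx cs x.1 x.2 = true) hp⟩
      cases h2 : mayOverlap P.size cs x.1 x.2
      · simp [h2] at h1
      · simpa [h2] using h1

end Search

/-! ### Labelled sets, affine equivalence and overlaps -/

variable {n K : ℕ}

/-- The multiset of the differences of a labelled set. -/
def diffs (a : Fin K → ZMod n) : Multiset (ZMod n) :=
  (Finset.univ : Finset (Fin K × Fin K)).val.map fun x => a x.1 - a x.2

theorem diffs_eq_sum (a : Fin K → ZMod n) : diffs a = ∑ i, ∑ j, {a i - a j} := by
  rw [← Finset.sum_product', Finset.univ_product_univ, diffs, Finset.sum_eq_multiset_sum]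
  rw [show (fun x : Fin K × Fin K => ({a x.1 - a x.2} : Multiset (ZMod n))) =
    (fun x => {x}) ∘ fun x => a x.1 - a x.2 from rfl, ← Multiset.map_map,
    Multiset.sum_map_singleton]

theorem diffs_comp (a : Fin K → ZMod n) (σ : Equiv.Perm (Fin K)) :
    diffs (fun i => a (σ i)) = diffs a := by
  rw [diffs_eq_sum, diffs_eq_sum]
  exact (Finset.sum_congr rfl fun i _ => Equiv.sum_comp σ fun j => {a (σ i) - a j}).trans
    (Equiv.sum_comp σ fun i => ∑ j, {a i - a j})

theorem diffs_neg (a : Fin K → ZMod n) : diffs (fun i => -a i) = diffs a := by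
  rw [diffs_eq_sum, diffs_eq_sum, Finset.sum_comm]
  exact Finset.sum_congr rfl fun i _ => Finset.sum_congr rfl fun j _ => by congr 1; ring

theorem diffs_add (a : Fin K → ZMod n) (c : ZMod n) : diffs (fun i => a i + c) = diffs a := by
  simp [diffs]

theorem diffs_mul (a : Fin K → ZMod n) (c : ZMod n) :
    diffs (fun i => c * a i) = (diffs a).map (c * ·) := by
  simp [diffs, mul_sub]

/-- Two labelled sets with the same differences. -/
structure Homometric (a b : Fin K → ZMod n) : Prop where
  injective_left : Function.Injective a
  injective_right : Function.Injective b
  diffs_eq : diffs a = diffs b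

theorem Homometric.transform {a b : Fin K → ZMod n} (h : Homometric a b) {e : ZMod n}
    (he : e = 1 ∨ e = -1) (σ τ : Equiv.Perm (Fin K)) (c d : ZMod n) :
    Homometric (fun i => e * a (σ i) + c) (fun i => b (τ i) + d) where
  injective_left i j hij := by
    have hij : e * a (σ i) = e * a (σ j) := add_right_cancel hij
    rcases he with rfl | rfl
    · exact σ.injective (h.injective_left (by simpa using hij))
    · exact σ.injective (h.injective_left (by simpa using hij))
  injective_right i j hij := τ.injective (h.injective_right (add_right_cancel hij))
  diffs_eq := by
    rw [diffs_add _ c, diffs_add _ d, diffs_comp b τ, ← h.diffs_eq, ← diffs_comp a σ]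
    rcases he with rfl | rfl
    · simp
    · simpa using diffs_neg fun i => a (σ i)

theorem Homometric.comp {a b : Fin K → ZMod n} (h : Homometric a b)
    (σ τ : Equiv.Perm (Fin K)) : Homometric (fun i => a (σ i)) (fun i => b (τ i)) := by
  simpa using h.transform (Or.inl rfl) σ τ 0 0

/-- Affine equivalence of labelled sets. -/
def IsAffine (a b : Fin K → ZMod n) : Prop :=
  ∃ (u : (ZMod n)ˣ) (v : ZMod n) (σ : Equiv.Perm (Fin K)), ∀ i, b (σ i) = u * a i + v

theorem IsAffine.of_transform {a b : Fin K → ZMod n} {e : ZMod n} (he : IsUnit e)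
    {σ τ : Equiv.Perm (Fin K)} {c d : ZMod n}
    (h : IsAffine (fun i => e * a (σ i) + c) (fun i => b (τ i) + d)) : IsAffine a b := by
  obtain ⟨u, v, ρ, h⟩ := h
  obtain ⟨e, rfl⟩ := he
  refine ⟨u * e, u * c + v - d, (σ.symm.trans ρ).trans τ, fun i => ?_⟩
  have := h (σ.symm i)
  simp only [Equiv.apply_symm_apply] at this
  simp only [Equiv.trans_apply, Units.val_mul]
  linear_combination this

theorem IsAffine.of_comp {a b : Fin K → ZMod n} (σ τ : Equiv.Perm (Fin K))
    (h : IsAffine (fun i => a (σ i)) (fun i => b (τ i))) : IsAffine a b :=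
  IsAffine.of_transform (e := 1) (c := 0) (d := 0) isUnit_one (σ := σ) (τ := τ) (by simpa using h)

/-- Some value is taken by `u a - b` at least `c` times. -/
def Overlap (u : ZMod n) (c : ℕ) (a b : Fin K → ZMod n) : Prop :=
  ∃ (σ τ : Equiv.Perm (Fin K)) (g : ZMod n), ∀ i : Fin K, (i : ℕ) < c → u * a (σ i) - b (τ i) = g

theorem exists_perm_extend (s : Fin K → Fin K) (c : ℕ)
    (hs : Set.InjOn s {i | (i : ℕ) < c}) :
    ∃ σ : Equiv.Perm (Fin K), ∀ i : Fin K, (i : ℕ) < c → σ i = s i := by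
  obtain ⟨g, hg⟩ := Finset.exists_equiv_extend_of_card_eq (α := Fin K) (t := Finset.univ)
    (by simp) (s := Finset.univ.filter fun i : Fin K => (i : ℕ) < c) (f := s)
    (by simp) (by simpa using hs)
  refine ⟨g.trans (Equiv.subtypeUnivEquiv fun x => Finset.mem_univ x), fun i hi => ?_⟩
  exact hg i (by simpa using hi)

/-- The equation u a i - b j = g determines each of i and j from the other, so distinct pairs have
distinct first and distinct second entries and extend to permutations. -/
theorem overlap_of_list {a b : Fin K → ZMod n} (ha : Function.Injective a)
    (hb : Function.Injective b) {u : ZMod n} (hu : IsUnit u) {c : ℕ} (l : List (Fin K × Fin K))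
    (hl : l.Nodup) (hc : c ≤ l.length) {g : ZMod n} (h : ∀ x ∈ l, u * a x.1 - b x.2 = g) :
    Overlap u c a b := by
  have key : ∀ i : Fin K, (i : ℕ) < c → l.getD i (i, i) ∈ l := by
    intro i hi
    rw [List.getD_eq_getElem _ _ (by omega)]
    exact List.getElem_mem _
  have hinj : ∀ i j : Fin K, (i : ℕ) < c → (j : ℕ) < c → l.getD i (i, i) = l.getD j (j, j) →
      i = j := by
    intro i j hi hj hij
    rw [List.getD_eq_getElem _ _ (by omega), List.getD_eq_getElem _ _ (by omega),
      hl.getElem_inj_iff] at hij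
    exact Fin.ext hij
  obtain ⟨σ, hσ⟩ := exists_perm_extend (fun i : Fin K => (l.getD i (i, i)).1) c (by
    intro i hi j hj hij
    refine hinj i j hi hj (Prod.ext hij (hb ?_))
    have h1 := h _ (key i hi)
    have h2 := h _ (key j hj)
    simp only at hij
    rw [hij] at h1
    linear_combination h2 - h1)
  obtain ⟨τ, hτ⟩ := exists_perm_extend (fun i : Fin K => (l.getD i (i, i)).2) c (by
    intro i hi j hj hij
    refine hinj i j hi hj (Prod.ext (ha (hu.mul_left_cancel ?_)) hij)
    have h1 := h _ (key i hi)
    have h2 := h _ (key j hj)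
    simp only at hij
    rw [hij] at h1
    linear_combination h1 - h2)
  exact ⟨σ, τ, g, fun i hi => by rw [hσ i hi, hτ i hi]; exact h _ (key i hi)⟩

theorem Overlap.isAffine {a b : Fin K → ZMod n} {u : ZMod n} (hu : IsUnit u)
    (h : Overlap u K a b) : IsAffine a b := by
  obtain ⟨σ, τ, g, h⟩ := h
  obtain ⟨u, rfl⟩ := hu
  refine ⟨u, -g, σ.symm.trans τ, fun i => ?_⟩
  have := h (σ.symm i) (Fin.is_lt _)
  rw [Equiv.apply_symm_apply] at this
  rw [Equiv.trans_apply]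
  linear_combination -this

/-- It suffices to treat labelled sets that overlap in their first points. -/
theorem isAffine_of_overlap [NeZero K] {a b : Fin K → ZMod n} (h : Homometric a b) {u : ZMod n}
    (hu : u = 1 ∨ u = -1) {c : ℕ} (ho : Overlap u c a b)
    (H : ∀ a b : Fin K → ZMod n, Homometric a b → a 0 = 0 → (∀ i : Fin K, (i : ℕ) < c → a i = b i) →
      IsAffine a b) : IsAffine a b := by
  obtain ⟨σ, τ, g, ho⟩ := ho
  have hu' : IsUnit u := by rcases hu with rfl | rfl <;> simp
  refine IsAffine.of_transform hu' (σ := σ) (τ := τ) (c := -(u * a (σ 0)))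
    (d := g - u * a (σ 0)) (H _ _ (h.transform hu _ _ _ _) (by ring) fun i hi => ?_)
  linear_combination ho i hi

/-! ### From labelled sets to the search -/

/-- The coordinates of a vector that lists the points of two labelled sets. -/
def joint (a b : Fin K → ZMod n) (i : ℕ) : ZMod n :=
  if h : i < K then a ⟨i, h⟩ else if h : i - K < K then b ⟨i - K, h⟩ else 0

theorem joint_left (a b : Fin K → ZMod n) (i : Fin K) : joint a b i = a i := by
  simp [joint]

theorem joint_right (a b : Fin K → ZMod n) (i : Fin K) : joint a b (K + i) = b i := by
  simp [joint]

theorem joint_of_le (a b : Fin K → ZMod n) {i : ℕ} (h : K + K ≤ i) : joint a b i = 0 := by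
  rw [joint, dif_neg (by omega), dif_neg (by omega)]

theorem injOn_joint_left {a b : Fin K → ZMod n} (h : Function.Injective a) :
    Set.InjOn (joint a b) (Set.Iio K) := by
  intro i hi j hj hij
  rw [← Fin.val_mk hi, ← Fin.val_mk hj, joint_left, joint_left] at hij
  exact congrArg Fin.val (h hij)

theorem injOn_joint_right {a b : Fin K → ZMod n} (h : Function.Injective b) :
    Set.InjOn (joint a b) (Set.Ico K (K + K)) := by
  rintro i ⟨hi, hi'⟩ j ⟨hj, hj'⟩ hij
  obtain ⟨i, rfl⟩ := Nat.exists_eq_add_of_le hi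
  obtain ⟨j, rfl⟩ := Nat.exists_eq_add_of_le hj
  rw [← Fin.val_mk (n := K) (show i < K by omega), ← Fin.val_mk (n := K) (show j < K by omega),
    joint_right, joint_right] at hij
  exact congrArg (K + ·) (congrArg Fin.val (h hij))

open Search

theorem nth_of_length_le {l : List ℤ} {i : ℕ} (h : l.length ≤ i) : nth l i = 0 := by
  induction l generalizing i with
  | nil => rfl
  | cons x l ih =>
    cases i with
    | zero => simp at h
    | succ i => exact ih (by simpa using h)

theorem sum_smul_mem_span (t : List (ZMod n)) (cols : List (List ℤ)) (p : ℕ → ZMod n)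
    (h : ∀ i, p i = (List.zipWith (fun t v => t * (nth v i : ZMod n)) t cols).sum) :
    p ∈ span n (cols.map fun v => (0, v)) := by
  induction cols generalizing t p with
  | nil =>
    have : p = 0 := funext fun i => by simp [h]
    rw [this]; exact zero_mem _
  | cons v cols ih =>
    cases t with
    | nil =>
      have : p = 0 := funext fun i => by simp [h]
      rw [this]; exact zero_mem _
    | cons s t =>
      have : p = s • vec n v + fun i => (List.zipWith (fun t v => t * (nth v i : ZMod n)) t cols).sum :=
        funext fun i => by simp [h, vec]
      rw [this]
      exact smul_add_mem_span_cons (by simp) v (ih t _ fun _ => rfl)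

/-- The list `t` holds the free parameters; each vector in `cols` holds the coefficients of one
parameter in the 2K points. -/
theorem joint_mem_span {a b : Fin K → ZMod n} (t : List (ZMod n)) (cols : List (List ℤ))
    (hcols : ∀ v ∈ cols, v.length = K + K)
    (ha : ∀ i : Fin K, a i = (List.zipWith (fun t v => t * (nth v i : ZMod n)) t cols).sum)
    (hb : ∀ i : Fin K, b i = (List.zipWith (fun t v => t * (nth v (K + i) : ZMod n)) t cols).sum) :
    joint a b ∈ span n (cols.map fun v => (0, v)) := by
  refine sum_smul_mem_span t cols _ fun i => ?_
  by_cases h1 : i < K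
  · exact (joint_left a b ⟨i, h1⟩).trans (ha ⟨i, h1⟩)
  by_cases h2 : i < K + K
  · obtain ⟨i, rfl⟩ := Nat.exists_eq_add_of_le (not_lt.1 h1)
    exact (joint_right a b ⟨i, by omega⟩).trans (hb ⟨i, by omega⟩)
  · rw [joint_of_le a b (not_lt.1 h2)]
    clear ha hb
    induction cols generalizing t with
    | nil => simp
    | cons v cols ih =>
      cases t with
      | nil => simp
      | cons s t =>
        have hv : nth v i = 0 := nth_of_length_le ((hcols v (by simp)).trans_le (not_lt.1 h2))
        simpa [hv] using ih t fun v hv => hcols v (by simp [hv])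

theorem overlap_of_countP {a b : Fin K → ZMod n} (h : Homometric a b) {u g : ZMod n}
    (hu : IsUnit u) {c : ℕ} {idx : List Edge}
    (hidx : idx = (List.finRange K ×ˢ List.finRange K).map fun x => (x.1.val, K + x.2.val))
    (hc : c ≤ idx.countP fun e => decide (u * joint a b e.1 - joint a b e.2 = g)) :
    Overlap u c a b := by
  rw [hidx, List.countP_map, List.countP_eq_length_filter] at hc
  refine overlap_of_list h.injective_left h.injective_right hu _
    (((List.nodup_finRange K).product (List.nodup_finRange K)).filter _) hc (g := g) fun x hx => ?_
  simpa [joint_left, joint_right] using (List.mem_filter.1 hx).2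

/-- The positive result of a search for labelled sets with given parametrization. -/
theorem Homometric.exists_overlap {a b : Fin K → ZMod n} (h : Homometric a b) {P : Params}
    (hsize : P.size = K) (hP : ∀ q ∈ P.primes, IsUnit (q : ZMod n))
    (hu : ∀ x ∈ P.shared, IsUnit (x.1 : ZMod n))
    (hidx : P.idx = (List.finRange K ×ˢ List.finRange K).map fun x => (x.1.val, K + x.2.val))
    {EA EB : List Edge} (hE : (EA.map (absDiff (joint a b))).Perm (EB.map (absDiff (joint a b))))
    {m : ℕ} {cols : List (List ℤ)} (hs : search P m (cols.map fun v => (0, v)) EA EB = true)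
    (hcols : ∀ v ∈ cols, v.length = K + K) (t : List (ZMod n))
    (ha : ∀ i : Fin K, a i = (List.zipWith (fun t v => t * (nth v i : ZMod n)) t cols).sum)
    (hb : ∀ i : Fin K, b i = (List.zipWith (fun t v => t * (nth v (K + i) : ZMod n)) t cols).sum) :
    ∃ x ∈ P.shared, Overlap (x.1 : ZMod n) x.2 a b := by
  subst hsize
  obtain ⟨x, hx, g, hg⟩ := search_spec hP (injOn_joint_left h.injective_left)
    (injOn_joint_right h.injective_right) hs (joint_mem_span t cols hcols ha hb) hE
  exact ⟨x, hx, overlap_of_countP h (hu x hx) hidx hg⟩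

/-! ### Sets without a threefold overlap -/

/-- Without overlaps, the differences from a fixed point of one set are differences in the other
set with distinct first points and with distinct second points. -/
theorem Homometric.exists_star [NeZero K] {a b : Fin K → ZMod n} (h : Homometric a b)
    (h1 : ¬ Overlap 1 3 a b) (h2 : ¬ Overlap (-1) 3 a b) :
    ∃ σ : Equiv.Perm (Fin K), ∃ ρ : Equiv.Perm (Fin K), (∀ j ≠ 0, ρ j ≠ j) ∧
      ∀ j ≠ 0, b j - b 0 = a (σ (ρ j)) - a (σ j) := by
  have key : ∀ j, ∃ w v : Fin K, b j - b 0 = a w - a v := by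
    intro j
    have : b j - b 0 ∈ diffs b := Multiset.mem_map.2 ⟨(j, 0), by simp, rfl⟩
    rw [← h.diffs_eq] at this
    obtain ⟨x, -, hx⟩ := Multiset.mem_map.1 this
    exact ⟨x.1, x.2, hx.symm⟩
  choose w v hwv using key
  have hne : ∀ j ≠ 0, w j ≠ v j := by
    intro j hj hjw
    have := hwv j
    rw [hjw, sub_self, sub_eq_zero] at this
    exact hj (h.injective_right this)
  have hw : ∀ j k, j ≠ 0 → k ≠ 0 → w j = w k → j = k := by
    intro j k hj hk hjk
    by_contra hne'
    -- With a common first point w, the value -a(w) - b 0 is also that of -a - b at (v j, j) and (v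
    -- k, k).
    refine h2 (overlap_of_list h.injective_left h.injective_right (by simp)
      [(v j, j), (v k, k), (w j, 0)] (by simp [hne', hj, hk]) le_rfl
      (g := -(a (w j)) - b 0) ?_)
    have e1 := hwv j
    have e2 := hwv k
    rw [← hjk] at e2
    simp only [List.mem_cons, List.not_mem_nil, or_false]
    rintro x (rfl | rfl | rfl)
    · linear_combination -e1
    · linear_combination -e2
    · ring
  have hv : ∀ j k, j ≠ 0 → k ≠ 0 → v j = v k → j = k := by
    intro j k hj hk hjk
    by_contra hne'
    -- With a common second point v, the value a(v) - b 0 is also that of a - b at (w j, j) and (w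
    -- k, k).
    refine h1 (overlap_of_list h.injective_left h.injective_right (by simp)
      [(w j, j), (w k, k), (v j, 0)] (by simp [hne', hj, hk]) le_rfl
      (g := a (v j) - b 0) ?_)
    have e1 := hwv j
    have e2 := hwv k
    rw [← hjk] at e2
    simp only [List.mem_cons, List.not_mem_nil, or_false]
    rintro x (rfl | rfl | rfl)
    · linear_combination -e1
    · linear_combination -e2
    · ring
  have hext : ∀ f : Fin K → Fin K, (∀ j k, j ≠ 0 → k ≠ 0 → f j = f k → j = k) →
      ∃ σ : Equiv.Perm (Fin K), ∀ j ≠ 0, σ j = f j := by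
    intro f hf
    obtain ⟨g, hg⟩ := Finset.exists_equiv_extend_of_card_eq (α := Fin K) (t := Finset.univ)
      (by simp) (s := Finset.univ.filter fun i : Fin K => i ≠ 0) (f := f)
      (by simp) (by
        intro j hj k hk hjk
        simp only [Finset.coe_filter, Finset.mem_univ, true_and, Set.mem_ofPred_eq] at hj hk
        exact hf j k hj hk hjk)
    exact ⟨g.trans (Equiv.subtypeUnivEquiv fun x => Finset.mem_univ x),
      fun i hi => hg i (by simpa using hi)⟩
  obtain ⟨σ, hσ⟩ := hext v hv
  obtain ⟨τ, hτ⟩ := hext w hw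
  -- The values of σ and τ at 0 are whatever completes the bijections, so ρ may fix 0 but no other
  -- index.
  refine ⟨σ, τ.trans σ.symm, fun j hj hj' => hne j hj ?_, fun j hj => ?_⟩
  · rw [Equiv.trans_apply, Equiv.symm_apply_eq, hσ j hj, hτ j hj] at hj'
    exact hj'
  · rw [Equiv.trans_apply, Equiv.apply_symm_apply, hσ j hj, hτ j hj]
    exact hwv j

/-- If no differences are shared, it suffices to treat a list of permutations that contains all
permutations up to conjugation. -/
theorem Homometric.isAffine_of_star [NeZero K] {a b : Fin K → ZMod n} (h : Homometric a b)
    (h1 : ¬ Overlap 1 3 a b) (h2 : ¬ Overlap (-1) 3 a b) (reps : List (Fin K → Fin K))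
    (hreps : ∀ ρ : Equiv.Perm (Fin K), (∀ j ≠ 0, ρ j ≠ j) → ∃ θ : Equiv.Perm (Fin K), θ 0 = 0 ∧
      ∃ r ∈ reps, ∀ j, ρ (θ j) = θ (r j))
    (H : ∀ r ∈ reps, ∀ a b : Fin K → ZMod n, Homometric a b → a 0 = 0 → b 0 = 0 →
      (∀ j ≠ 0, b j = a (r j) - a j) → IsAffine a b) : IsAffine a b := by
  obtain ⟨σ, ρ, hρ, hab⟩ := h.exists_star h1 h2
  obtain ⟨θ, hθ, r, hr, hθr⟩ := hreps ρ hρ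
  refine IsAffine.of_transform (e := 1) isUnit_one (σ := θ.trans σ) (τ := θ)
    (c := -a (σ (θ 0))) (d := -b 0)
    (H r hr _ _ (h.transform (Or.inl rfl) _ _ _ _) (by simp) (by simp [hθ]) fun j hj => ?_)
  have := hab (θ j) (fun e => hj (θ.injective (e.trans hθ.symm)))
  rw [hθr] at this
  simp only [Equiv.trans_apply]
  linear_combination this

/-! ### From labelled sets to finite sets -/

theorem exists_enumeration {A : Finset (ZMod n)} (h : A.card = K) :
    ∃ a : Fin K ↪ ZMod n, Finset.univ.map a = A := by
  refine ⟨(A.equivFinOfCardEq h).symm.toEmbedding.trans (Function.Embedding.subtype _), ?_⟩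
  ext x
  simp only [Finset.mem_map, Finset.mem_univ, true_and]
  constructor
  · rintro ⟨i, rfl⟩
    exact ((A.equivFinOfCardEq h).symm i).2
  · intro hx
    exact ⟨A.equivFinOfCardEq h ⟨x, hx⟩, by simp⟩

theorem diffMultiset_map (a : Fin K ↪ ZMod n) : diffMultiset (Finset.univ.map a) = diffs a := by
  rw [diffMultiset, ← Finset.prodMap_map_product, Finset.univ_product_univ, Finset.map_val,
    Multiset.map_map]
  rfl

theorem sda_of_homometric (H : ∀ a b : Fin K → ZMod n, Homometric a b → IsAffine a b) :
    SDA n K := by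
  intro A B hA hB
  obtain ⟨a, rfl⟩ := exists_enumeration hA
  obtain ⟨b, rfl⟩ := exists_enumeration hB
  rw [LinearlyEquivalent, diffMultiset_map, diffMultiset_map]
  constructor
  · rintro ⟨u, hu⟩
    have h : Homometric (fun i => (u : ZMod n) * a i) b :=
      ⟨fun i j hij => a.injective (u.isUnit.mul_left_cancel hij), b.injective,
        (diffs_mul _ _).trans hu.symm⟩
    obtain ⟨e, v, σ, h⟩ := IsAffine.of_transform (e := (u : ZMod n)) (c := 0) (d := 0) u.isUnit
      (σ := Equiv.refl _) (τ := Equiv.refl _) (a := a) (b := b) (by simpa using H _ _ h)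
    refine ⟨e, v, ?_⟩
    ext x
    simp only [Finset.mem_map, Finset.mem_univ, true_and, Finset.mem_image, exists_exists_eq_and]
    constructor
    · rintro ⟨i, rfl⟩
      exact ⟨σ.symm i, by rw [← h, Equiv.apply_symm_apply]⟩
    · rintro ⟨i, rfl⟩
      exact ⟨σ i, h i⟩
  · rintro ⟨u, v, h⟩
    refine ⟨u, ?_⟩
    have hinj : Function.Injective fun i => (u : ZMod n) * a i + v := fun i j hij =>
      a.injective (u.isUnit.mul_left_cancel (add_right_cancel hij))
    have : Finset.univ.map b = Finset.univ.map ⟨fun i => (u : ZMod n) * a i + v, hinj⟩ := by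
      rw [h]; ext x; simp
    rw [← diffMultiset_map b, this, diffMultiset_map]
    exact (diffs_add (fun i => (u : ZMod n) * a i) v).trans (diffs_mul _ _)

/-! ### Differences up to sign as edge lists -/

theorem sum_sum_of_symm_four {α : Type*} [AddCommMonoid α] {f : Fin 4 → Fin 4 → α} {z : α}
    (h : ∀ i, f i i = z) (hs : ∀ i j, f i j = f j i) : ∑ i, ∑ j, f i j =
      4 • z + 2 • (f 0 1 + f 0 2 + f 1 2 + f 0 3 + f 1 3 + f 2 3) := by
  simp only [Fin.sum_univ_four, h, hs 1 0, hs 2 0, hs 2 1, hs 3 0, hs 3 1, hs 3 2]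
  abel

theorem sum_sum_of_symm_five {α : Type*} [AddCommMonoid α] {f : Fin 5 → Fin 5 → α} {z : α}
    (h : ∀ i, f i i = z) (hs : ∀ i j, f i j = f j i) : ∑ i, ∑ j, f i j =
      5 • z + 2 • (f 0 1 + f 0 2 + f 1 2 + f 0 3 + f 1 3 + f 2 3 + f 0 4 + f 1 4 + f 2 4 +
        f 3 4) := by
  simp only [Fin.sum_univ_five, h, hs 1 0, hs 2 0, hs 2 1, hs 3 0, hs 3 1, hs 3 2, hs 4 0, hs 4 1,
    hs 4 2, hs 4 3]
  abel

theorem map_diffs (a : Fin K → ZMod n) :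
    (diffs a).map (fun x => s(x, -x)) = ∑ i, ∑ j, {s(a i - a j, -(a i - a j))} := by
  rw [diffs_eq_sum, ← Multiset.coe_mapAddMonoidHom]
  simp only [map_sum, Multiset.coe_mapAddMonoidHom, Multiset.map_singleton]

theorem singleton_sub_comm (x y : ZMod n) :
    ({s(x - y, -(x - y))} : Multiset (Sym2 (ZMod n))) = {s(y - x, -(y - x))} := by
  rw [neg_sub, neg_sub, Sym2.eq_swap]

theorem two_smul_injective {α : Type*} {s t : Multiset α} (h : 2 • s = 2 • t) : s = t := by
  classical
  ext x
  have := congrArg (Multiset.count x) h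
  rw [Multiset.count_nsmul, Multiset.count_nsmul] at this
  omega

noncomputable def leftEdges₄ : List Edge := [(0,1),(0,2),(1,2),(0,3),(1,3),(2,3)]
noncomputable def rightEdges₄ : List Edge := [(4,5),(4,6),(5,6),(4,7),(5,7),(6,7)]

/-- Identifying x with -x makes the double sum symmetric: the diagonal contributes the same to both
sides and every pair counts twice. Cancelling and halving multisets leaves one entry per pair. -/
theorem Homometric.perm_four {a b : Fin 4 → ZMod n} (h : Homometric a b) :
    (leftEdges₄.map (absDiff (joint a b))).Perm (rightEdges₄.map (absDiff (joint a b))) := by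
  have := congrArg (Multiset.map fun x => s(x, -x)) h.diffs_eq
  rw [map_diffs, map_diffs, sum_sum_of_symm_four (z := {s(0, -0)}) (by simp)
    (fun i j => singleton_sub_comm _ _), sum_sum_of_symm_four (z := {s(0, -0)}) (by simp)
    (fun i j => singleton_sub_comm _ _)] at this
  exact Multiset.coe_eq_coe.1 (two_smul_injective (add_left_cancel this))

noncomputable def leftEdges₅ : List Edge :=
  [(0,1),(0,2),(1,2),(0,3),(1,3),(2,3),(0,4),(1,4),(2,4),(3,4)]
noncomputable def rightEdges₅ : List Edge :=
  [(5,6),(5,7),(6,7),(5,8),(6,8),(7,8),(5,9),(6,9),(7,9),(8,9)]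

theorem Homometric.perm_five {a b : Fin 5 → ZMod n} (h : Homometric a b) :
    (leftEdges₅.map (absDiff (joint a b))).Perm (rightEdges₅.map (absDiff (joint a b))) := by
  have := congrArg (Multiset.map fun x => s(x, -x)) h.diffs_eq
  rw [map_diffs, map_diffs, sum_sum_of_symm_five (z := {s(0, -0)}) (by simp)
    (fun i j => singleton_sub_comm _ _), sum_sum_of_symm_five (z := {s(0, -0)}) (by simp)
    (fun i j => singleton_sub_comm _ _)] at this
  exact Multiset.coe_eq_coe.1 (two_smul_injective (add_left_cancel this))

/-! ### Search parameters -/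

noncomputable def params₄ (c : ℕ) : Params where
  size := 4
  idx := [(0,4),(0,5),(0,6),(0,7),(1,4),(1,5),(1,6),(1,7),(2,4),(2,5),(2,6),(2,7),(3,4),(3,5),
    (3,6),(3,7)]
  primes := [2]
  -- The multipliers ±2 are needed: the difference set {0, 1, 3, 9} modulo 13 and its double have
  -- the same differences but no threefold overlap up to sign.
  shared := [(1, c), (-1, c), (2, 4), (-2, 4)]

noncomputable def params₅ (c : ℕ) : Params where
  size := 5
  idx := [(0,5),(0,6),(0,7),(0,8),(0,9),(1,5),(1,6),(1,7),(1,8),(1,9),(2,5),(2,6),(2,7),(2,8),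
    (2,9),(3,5),(3,6),(3,7),(3,8),(3,9),(4,5),(4,6),(4,7),(4,8),(4,9)]
  primes := [2, 5]
  shared := [(1, c), (-1, c)]

theorem Homometric.overlap_four {a b : Fin 4 → ZMod n} (h : Homometric a b)
    (h2 : IsUnit (2 : ZMod n)) {c : ℕ} (cols : List (List ℤ)) (t : List (ZMod n))
    -- Every level uses up an edge of B, so six edges need at most seven levels; ten edges need
    -- eleven.
    (hs : search (params₄ c) 7 (cols.map fun v => (0, v)) leftEdges₄ rightEdges₄ = true)
    (hcols : ∀ v ∈ cols, v.length = 8)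
    (ha : ∀ i : Fin 4, a i = (List.zipWith (fun t v => t * (nth v i : ZMod n)) t cols).sum)
    (hb : ∀ i : Fin 4, b i = (List.zipWith (fun t v => t * (nth v (4 + i) : ZMod n)) t cols).sum) :
    IsAffine a b ∨ Overlap 1 c a b ∨ Overlap (-1) c a b := by
  obtain ⟨x, hx, ho⟩ := h.exists_overlap (P := params₄ c) rfl (by simpa [params₄] using h2)
    (by simpa [params₄] using h2) rfl h.perm_four hs hcols t ha hb
  simp only [params₄, List.mem_cons, List.not_mem_nil, or_false] at hx
  rcases hx with rfl | rfl | rfl | rfl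
  · exact Or.inr (Or.inl (by simpa using ho))
  · exact Or.inr (Or.inr (by simpa using ho))
  · exact Or.inl (Overlap.isAffine (by simpa using h2) ho)
  · exact Or.inl (Overlap.isAffine (by simpa using h2) ho)

theorem Homometric.overlap_five {a b : Fin 5 → ZMod n} (h : Homometric a b)
    (h2 : IsUnit (2 : ZMod n)) (h5 : IsUnit (5 : ZMod n)) {c : ℕ} (cols : List (List ℤ))
    (t : List (ZMod n)) (EB : List Edge) (hEB : rightEdges₅.Perm EB)
    (hs : search (params₅ c) 11 (cols.map fun v => (0, v)) leftEdges₅ EB = true)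
    (hcols : ∀ v ∈ cols, v.length = 10)
    (ha : ∀ i : Fin 5, a i = (List.zipWith (fun t v => t * (nth v i : ZMod n)) t cols).sum)
    (hb : ∀ i : Fin 5, b i = (List.zipWith (fun t v => t * (nth v (5 + i) : ZMod n)) t cols).sum) :
    Overlap 1 c a b ∨ Overlap (-1) c a b := by
  obtain ⟨x, hx, ho⟩ := h.exists_overlap (P := params₅ c) rfl
    (by simpa [params₅] using ⟨h2, h5⟩) (by simp [params₅]) rfl
    (h.perm_five.trans (hEB.map _)) hs hcols t ha hb
  simp only [params₅, List.mem_cons, List.not_mem_nil, or_false] at hx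
  rcases hx with rfl | rfl
  · exact Or.inl (by simpa using ho)
  · exact Or.inr (by simpa using ho)

theorem isAffine_of_overlap_or {K : ℕ} {a b : Fin K → ZMod n}
    (h : Overlap 1 K a b ∨ Overlap (-1) K a b) : IsAffine a b :=
  h.elim (Overlap.isAffine isUnit_one) (Overlap.isAffine (by simp))

/-! ### Four points -/

theorem Homometric.isAffine_of_three {a b : Fin 4 → ZMod n} (h : Homometric a b)
    (h2 : IsUnit (2 : ZMod n)) (h0 : a 0 = 0) (hab : ∀ i : Fin 4, (i : ℕ) < 3 → a i = b i) :
    IsAffine a b := by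
  have e0 := hab 0 (by simp)
  have e1 := hab 1 (by simp)
  have e2 := hab 2 (by simp)
  refine (h.overlap_four h2 (c := 4) [[0,1,0,0,0,1,0,0],[0,0,1,0,0,0,1,0],[0,0,0,1,0,0,0,0],
    [0,0,0,0,0,0,0,1]] [a 1, a 2, a 3, b 3] (by decide +kernel) (by simp) (fun i => ?_)
    (fun i => ?_)).elim id isAffine_of_overlap_or
  · fin_cases i <;> simp [h0]
  · fin_cases i <;> simp [← e0, ← e1, ← e2, h0]

/-- Here b is a linear function of the parameters a 1, a 2, a 3, so the columns are read off from
`r`. -/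
theorem Homometric.overlap_four_of_star {a b : Fin 4 → ZMod n} (h : Homometric a b)
    (h2 : IsUnit (2 : ZMod n)) (ha : a 0 = 0) (hb : b 0 = 0) (r : Fin 4 → Fin 4)
    (hr : r ∈ [![1,2,3,0],![0,2,3,1],![1,0,3,2]]) (hab : ∀ j ≠ 0, b j = a (r j) - a j) :
    IsAffine a b ∨ Overlap 1 3 a b ∨ Overlap (-1) 3 a b := by
  have e1 := hab 1 (by simp)
  have e2 := hab 2 (by simp)
  have e3 := hab 3 (by simp)
  simp only [List.mem_cons, List.not_mem_nil, or_false] at hr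
  rcases hr with rfl | rfl | rfl
  · refine h.overlap_four h2 [[0,1,0,0,0,-1,0,0],[0,0,1,0,0,1,-1,0],[0,0,0,1,0,0,1,-1]]
      [a 1, a 2, a 3] (by decide +kernel) (by simp) (fun i => ?_) (fun i => ?_)
    · fin_cases i <;> simp [ha]
    · fin_cases i <;> simp [hb, ha, e1, e2, e3] <;> ring
  · refine h.overlap_four h2 [[0,1,0,0,0,-1,0,1],[0,0,1,0,0,1,-1,0],[0,0,0,1,0,0,1,-1]]
      [a 1, a 2, a 3] (by decide +kernel) (by simp) (fun i => ?_) (fun i => ?_)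
    · fin_cases i <;> simp [ha]
    · fin_cases i <;> simp [hb, e1, e2, e3] <;> ring
  · refine h.overlap_four h2 [[0,1,0,0,0,-1,0,0],[0,0,1,0,0,0,-1,1],[0,0,0,1,0,0,1,-1]]
      [a 1, a 2, a 3] (by decide +kernel) (by simp) (fun i => ?_) (fun i => ?_)
    · fin_cases i <;> simp [ha]
    · fin_cases i <;> simp [hb, ha, e1, e2, e3] <;> ring

theorem Homometric.isAffine_four {a b : Fin 4 → ZMod n} (h : Homometric a b)
    (h2 : IsUnit (2 : ZMod n)) : IsAffine a b := by
  have key : ∀ {a b : Fin 4 → ZMod n}, Homometric a b → ∀ {u : ZMod n}, u = 1 ∨ u = -1 →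
      Overlap u 3 a b → IsAffine a b := fun h _ hu ho =>
    isAffine_of_overlap h hu ho fun a b h h0 hab => h.isAffine_of_three h2 h0 hab
  by_cases h1 : Overlap 1 3 a b
  · exact key h (Or.inl rfl) h1
  by_cases h1' : Overlap (-1) 3 a b
  · exact key h (Or.inr rfl) h1'
  -- Up to conjugation fixing 0, the cycle of 0 has length 4, 1 or 2, and the rest splits into
  -- cycles of length at least 2; length 3 would leave another fixed point.
  refine h.isAffine_of_star h1 h1' [![1,2,3,0],![0,2,3,1],![1,0,3,2]] (by decide +kernel)
    fun r hr a b h ha hb hab => ?_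
  rcases h.overlap_four_of_star h2 ha hb r hr hab with h' | h' | h'
  · exact h'
  · exact key h (Or.inl rfl) h'
  · exact key h (Or.inr rfl) h'

/-! ### Five points -/

theorem Homometric.isAffine_of_four {a b : Fin 5 → ZMod n} (h : Homometric a b)
    (h2 : IsUnit (2 : ZMod n)) (h5 : IsUnit (5 : ZMod n)) (h0 : a 0 = 0)
    (hab : ∀ i : Fin 5, (i : ℕ) < 4 → a i = b i) : IsAffine a b := by
  have e0 := hab 0 (by simp)
  have e1 := hab 1 (by simp)
  have e2 := hab 2 (by simp)
  have e3 := hab 3 (by simp)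
  refine isAffine_of_overlap_or (h.overlap_five h2 h5 (c := 5) [[0,1,0,0,0,0,1,0,0,0],
    [0,0,1,0,0,0,0,1,0,0],[0,0,0,1,0,0,0,0,1,0],[0,0,0,0,1,0,0,0,0,0],[0,0,0,0,0,0,0,0,0,1]]
    [a 1, a 2, a 3, a 4, b 4] rightEdges₅ (List.Perm.refl _) (by decide +kernel) (by simp)
    (fun i => ?_) (fun i => ?_))
  · fin_cases i <;> simp [h0]
  · fin_cases i <;> simp [← e0, ← e1, ← e2, ← e3, h0]

theorem Homometric.isAffine_of_overlap_four {a b : Fin 5 → ZMod n} (h : Homometric a b)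
    (h2 : IsUnit (2 : ZMod n)) (h5 : IsUnit (5 : ZMod n))
    (ho : Overlap 1 4 a b ∨ Overlap (-1) 4 a b) : IsAffine a b :=
  ho.elim
    (fun ho => isAffine_of_overlap h (Or.inl rfl) ho fun _ _ h h0 hab =>
      h.isAffine_of_four h2 h5 h0 hab)
    (fun ho => isAffine_of_overlap h (Or.inr rfl) ho fun _ _ h h0 hab =>
      h.isAffine_of_four h2 h5 h0 hab)

/-- The extra relation eliminates b 3, leaving the parameters a 1, ..., a 4 and b 4; the search
reaches a fourfold overlap. -/
theorem Homometric.isAffine_of_sub_eq {a b : Fin 5 → ZMod n} (h : Homometric a b)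
    (h2 : IsUnit (2 : ZMod n)) (h5 : IsUnit (5 : ZMod n)) (h0 : a 0 = 0)
    (hab : ∀ i : Fin 5, (i : ℕ) < 3 → a i = b i) (h34 : b 3 - b 4 = a 3 - a 4) :
    IsAffine a b := by
  have e0 := hab 0 (by simp)
  have e1 := hab 1 (by simp)
  have e2 := hab 2 (by simp)
  have e3 : b 3 = a 3 - a 4 + b 4 := by linear_combination h34
  refine h.isAffine_of_overlap_four h2 h5 (h.overlap_five h2 h5 [[0,1,0,0,0,0,1,0,0,0],
    [0,0,1,0,0,0,0,1,0,0],[0,0,0,1,0,0,0,0,1,0],[0,0,0,0,1,0,0,0,-1,0],[0,0,0,0,0,0,0,0,1,1]]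
    [a 1, a 2, a 3, a 4, b 4] rightEdges₅ (List.Perm.refl _) (by decide +kernel) (by simp)
    (fun i => ?_) (fun i => ?_))
  · fin_cases i <;> simp [h0]
  · fin_cases i <;> simp [← e0, ← e1, ← e2, e3, h0]
    ring

theorem Homometric.isAffine_of_sub_eq' {a b : Fin 5 → ZMod n} (h : Homometric a b)
    (h2 : IsUnit (2 : ZMod n)) (h5 : IsUnit (5 : ZMod n)) (h0 : a 0 = 0)
    (hab : ∀ i : Fin 5, (i : ℕ) < 3 → a i = b i) (h34 : b 3 - b 4 = a 0 - a 3) :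
    IsAffine a b := by
  have e0 := hab 0 (by simp)
  have e1 := hab 1 (by simp)
  have e2 := hab 2 (by simp)
  have e3 : b 3 = -a 3 + b 4 := by rw [h0] at h34; linear_combination h34
  refine h.isAffine_of_overlap_four h2 h5 (h.overlap_five h2 h5 [[0,1,0,0,0,0,1,0,0,0],
    [0,0,1,0,0,0,0,1,0,0],[0,0,0,1,0,0,0,0,-1,0],[0,0,0,0,1,0,0,0,0,0],[0,0,0,0,0,0,0,0,1,1]]
    [a 1, a 2, a 3, a 4, b 4]
    -- The order of the edges of B is free; it only fixes the order of branching.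
    [(6,9),(5,8),(5,9),(7,9),(6,8),(7,8),(8,9),(5,6),(5,7),(6,7)] (by decide) (by decide +kernel)
    (by simp) (fun i => ?_) (fun i => ?_))
  · fin_cases i <;> simp [h0]
  · fin_cases i <;> simp [← e0, ← e1, ← e2, e3, h0]

/-- Permuting the three common points alike in both sets, and the last two points independently in
each, moves the relation to b 3 - b 4 = a 0 - a 3. -/
theorem Homometric.isAffine_of_sub_eq_sub {a b : Fin 5 → ZMod n} (h : Homometric a b)
    (h2 : IsUnit (2 : ZMod n)) (h5 : IsUnit (5 : ZMod n))
    (hab : ∀ i : Fin 5, (i : ℕ) < 3 → a i = b i) {i k : Fin 5} (hi : (i : ℕ) < 3)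
    (hk : 3 ≤ (k : ℕ)) {l m : Fin 5} (hlm : l = 3 ∧ m = 4 ∨ l = 4 ∧ m = 3)
    (hb : b l - b m = a i - a k) : IsAffine a b := by
  have key : ∃ σ τ : Equiv.Perm (Fin 5), σ 0 = i ∧ σ 3 = k ∧ τ 3 = l ∧ τ 4 = m ∧
      ∀ j : Fin 5, (j : ℕ) < 3 → σ j = τ j ∧ (σ j : ℕ) < 3 := by
    refine ⟨Equiv.swap 3 k * Equiv.swap 0 i, Equiv.swap 3 l * Equiv.swap 0 i, ?_⟩
    clear hb
    revert i k l m
    decide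
  obtain ⟨σ, τ, rfl, rfl, rfl, rfl, hστ⟩ := key
  refine IsAffine.of_transform (e := 1) isUnit_one (σ := σ) (τ := τ) (c := -a (σ 0))
    (d := -a (σ 0)) (Homometric.isAffine_of_sub_eq' (h.transform (Or.inl rfl) _ _ _ _) h2 h5
      (by simp) (fun j hj => ?_) ?_)
  · rw [one_mul, (hστ j hj).1, hab _ ((hστ j hj).1 ▸ (hστ j hj).2)]
  · linear_combination hb

theorem absDiff_joint_eq {K : ℕ} {a b : Fin K → ZMod n} {i j k l : Fin K}
    (h : absDiff (joint a b) (i, j) = absDiff (joint a b) (K + k, K + l)) :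
    b k - b l = a i - a j ∨ b l - b k = a i - a j := by
  rcases absDiff_eq_iff.1 h with h | h
  · left
    have : a i - a j - (b k - b l) = 0 := by
      simpa only [edgeMap, LinearMap.sub_apply, LinearMap.proj_apply, joint_left, joint_right]
        using h
    linear_combination -this
  · right
    have : a i - a j + (b k - b l) = 0 := by
      simpa only [edgeMap, LinearMap.sub_apply, LinearMap.proj_apply, joint_left, joint_right]
        using h
    linear_combination -this

/-- Once the three common differences are cancelled, ±(b 3 - b 4) is a 3 - a 4 or one of the six
differences between a common point and a 3 or a 4. Swapping b 3 and b 4 takes care of the sign. -/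
theorem Homometric.isAffine_of_first_three {a b : Fin 5 → ZMod n} (h : Homometric a b)
    (h2 : IsUnit (2 : ZMod n)) (h5 : IsUnit (5 : ZMod n)) (h0 : a 0 = 0)
    (hab : ∀ i : Fin 5, (i : ℕ) < 3 → a i = b i) : IsAffine a b := by
  have hE := h.perm_five
  have hj : ∀ i : Fin 5, (i : ℕ) < 3 → joint a b (5 + i) = joint a b i := fun i hi => by
    rw [joint_left, joint_right, hab i hi]
  have j0 : joint a b 5 = joint a b 0 := hj 0 (by simp)
  have j1 : joint a b 6 = joint a b 1 := hj 1 (by simp)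
  have j2 : joint a b 7 = joint a b 2 := hj 2 (by simp)
  have e1 : absDiff (joint a b) (5, 6) = absDiff (joint a b) (0, 1) := by
    simp only [absDiff, j0, j1]
  have e2 : absDiff (joint a b) (5, 7) = absDiff (joint a b) (0, 2) := by
    simp only [absDiff, j0, j2]
  have e3 : absDiff (joint a b) (6, 7) = absDiff (joint a b) (1, 2) := by
    simp only [absDiff, j1, j2]
  simp only [leftEdges₅, rightEdges₅, List.map_cons, List.map_nil, e1, e2, e3, List.perm_cons]
    at hE
  have hmem := hE.mem_iff.2 (show absDiff (joint a b) (8, 9) ∈ _ by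
    simp only [List.mem_cons]; tauto)
  simp only [List.mem_cons, List.not_mem_nil, or_false] at hmem
  have key : ∀ i k : Fin 5, (i : ℕ) < 3 → 3 ≤ (k : ℕ) →
      absDiff (joint a b) (8, 9) = absDiff (joint a b) (i, k) → IsAffine a b := by
    intro i k hi hk h'
    rcases absDiff_joint_eq (k := 3) (l := 4) h'.symm with h' | h'
    · exact h.isAffine_of_sub_eq_sub h2 h5 hab hi hk (Or.inl ⟨rfl, rfl⟩) h'
    · exact h.isAffine_of_sub_eq_sub h2 h5 hab hi hk (Or.inr ⟨rfl, rfl⟩) h'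
  rcases hmem with h' | h' | h' | h' | h' | h' | h'
  · exact key 0 3 (by simp) (by simp) h'
  · exact key 1 3 (by simp) (by simp) h'
  · exact key 2 3 (by simp) (by simp) h'
  · exact key 0 4 (by simp) (by simp) h'
  · exact key 1 4 (by simp) (by simp) h'
  · exact key 2 4 (by simp) (by simp) h'
  · rcases absDiff_joint_eq (i := 3) (j := 4) (k := 3) (l := 4) h'.symm with h' | h'
    · exact h.isAffine_of_sub_eq h2 h5 h0 hab h'
    · refine IsAffine.of_comp (Equiv.refl _) (Equiv.swap 3 4)
        ((h.comp (Equiv.refl _) (Equiv.swap 3 4)).isAffine_of_sub_eq h2 h5 h0 (fun i hi => ?_) h')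
      have : Equiv.swap 3 4 i = i := by
        revert i
        decide
      rw [this]
      exact hab i hi

theorem Homometric.overlap_five_of_star {a b : Fin 5 → ZMod n} (h : Homometric a b)
    (h2 : IsUnit (2 : ZMod n)) (h5 : IsUnit (5 : ZMod n)) (ha : a 0 = 0) (hb : b 0 = 0)
    (r : Fin 5 → Fin 5)
    (hr : r ∈ [![1,2,3,4,0],![0,2,3,4,1],![1,0,3,4,2],![1,2,0,4,3],![0,2,1,4,3]])
    (hab : ∀ j ≠ 0, b j = a (r j) - a j) : Overlap 1 3 a b ∨ Overlap (-1) 3 a b := by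
  have e1 := hab 1 (by simp)
  have e2 := hab 2 (by simp)
  have e3 := hab 3 (by simp)
  have e4 := hab 4 (by simp)
  simp only [List.mem_cons, List.not_mem_nil, or_false] at hr
  rcases hr with rfl | rfl | rfl | rfl | rfl
  · refine h.overlap_five h2 h5 [[0,1,0,0,0,0,-1,0,0,0],[0,0,1,0,0,0,1,-1,0,0],
      [0,0,0,1,0,0,0,1,-1,0],[0,0,0,0,1,0,0,0,1,-1]] [a 1, a 2, a 3, a 4] rightEdges₅
      (List.Perm.refl _) (by decide +kernel) (by simp) (fun i => ?_) (fun i => ?_)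
    · fin_cases i <;> simp [ha]
    · fin_cases i <;> simp [hb, ha, e1, e2, e3, e4] <;> ring
  · refine h.overlap_five h2 h5 [[0,1,0,0,0,0,-1,0,0,1],[0,0,1,0,0,0,1,-1,0,0],
      [0,0,0,1,0,0,0,1,-1,0],[0,0,0,0,1,0,0,0,1,-1]] [a 1, a 2, a 3, a 4] rightEdges₅
      (List.Perm.refl _) (by decide +kernel) (by simp) (fun i => ?_) (fun i => ?_)
    · fin_cases i <;> simp [ha]
    · fin_cases i <;> simp [hb, e1, e2, e3, e4] <;> ring
  · refine h.overlap_five h2 h5 [[0,1,0,0,0,0,-1,0,0,0],[0,0,1,0,0,0,0,-1,0,1],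
      [0,0,0,1,0,0,0,1,-1,0],[0,0,0,0,1,0,0,0,1,-1]] [a 1, a 2, a 3, a 4] rightEdges₅
      (List.Perm.refl _) (by decide +kernel) (by simp) (fun i => ?_) (fun i => ?_)
    · fin_cases i <;> simp [ha]
    · fin_cases i <;> simp [hb, ha, e1, e2, e3, e4] <;> ring
  · refine h.overlap_five h2 h5 [[0,1,0,0,0,0,-1,0,0,0],[0,0,1,0,0,0,1,-1,0,0],
      [0,0,0,1,0,0,0,0,-1,1],[0,0,0,0,1,0,0,0,1,-1]] [a 1, a 2, a 3, a 4] rightEdges₅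
      (List.Perm.refl _) (by decide +kernel) (by simp) (fun i => ?_) (fun i => ?_)
    · fin_cases i <;> simp [ha]
    · fin_cases i <;> simp [hb, ha, e1, e2, e3, e4] <;> ring
  · refine h.overlap_five h2 h5 [[0,1,0,0,0,0,-1,1,0,0],[0,0,1,0,0,0,1,-1,0,0],
      [0,0,0,1,0,0,0,0,-1,1],[0,0,0,0,1,0,0,0,1,-1]] [a 1, a 2, a 3, a 4] rightEdges₅
      (List.Perm.refl _) (by decide +kernel) (by simp) (fun i => ?_) (fun i => ?_)
    · fin_cases i <;> simp [ha]
    · fin_cases i <;> simp [hb, e1, e2, e3, e4] <;> ring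

theorem Homometric.isAffine_five {a b : Fin 5 → ZMod n} (h : Homometric a b)
    (h2 : IsUnit (2 : ZMod n)) (h5 : IsUnit (5 : ZMod n)) : IsAffine a b := by
  have key : ∀ {a b : Fin 5 → ZMod n}, Homometric a b → ∀ {u : ZMod n}, u = 1 ∨ u = -1 →
      Overlap u 3 a b → IsAffine a b := fun h _ hu ho =>
    isAffine_of_overlap h hu ho fun _ _ h h0 hab => h.isAffine_of_first_three h2 h5 h0 hab
  by_cases h1 : Overlap 1 3 a b
  · exact key h (Or.inl rfl) h1
  by_cases h1' : Overlap (-1) 3 a b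
  · exact key h (Or.inr rfl) h1'
  -- Writing the length of the cycle of 0 first, the cycle types are 5, 1+4, 2+3, 3+2 and 1+2+2.
  refine h.isAffine_of_star h1 h1'
    [![1,2,3,4,0],![0,2,3,4,1],![1,0,3,4,2],![1,2,0,4,3],![0,2,1,4,3]] (by decide +kernel)
    fun r hr a b h ha hb hab => ?_
  rcases h.overlap_five_of_star h2 h5 ha hb r hr hab with h' | h'
  · exact key h (Or.inl rfl) h'
  · exact key h (Or.inr rfl) h'

end Circulant

theorem mainTheorem7 (n : ℕ) :
    (Odd n → Circulant.SDA n 4) ∧ (Nat.Coprime n 10 → Circulant.SDA n 5) := by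
  have hunit : ∀ m : ℕ, Nat.Coprime n m → IsUnit (m : ZMod n) := fun m hm =>
    (ZMod.isUnit_iff_coprime m n).2 hm.symm
  refine ⟨fun hn => ?_, fun hn => ?_⟩
  · have h2 : IsUnit (2 : ZMod n) := hunit 2 (Nat.coprime_two_right.2 hn)
    exact Circulant.sda_of_homometric fun a b h => h.isAffine_four h2
  · have h2 : IsUnit (2 : ZMod n) := hunit 2 (hn.coprime_dvd_right (by norm_num))
    have h5 : IsUnit (5 : ZMod n) := hunit 5 (hn.coprime_dvd_right (by norm_num))
    exact Circulant.sda_of_homometric fun a b h => h.isAffine_five h2 h5
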